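/- **Setting.** For a countable set $I$ and $u,u'\in\mathbb R_{\ge0}^I$ put $\langle u,u'\rangle=\sum_{i\in I}u_iu'_i\in[0,\infty]$, and for $\mathcal X\subseteq\mathbb R_{\ge0}^I$ put $\mathcal X^\perp=\{u'\mid\forall u\in\mathcal X,\ \langle u,u'\rangle\le1\}$. A *probabilistic coherence space* (PCS) $X$ consists of a countable set $|X|$ (its web) and a set $\mathsf P X\subseteq\mathbb R_{\ge0}^{|X|}$ with $\mathsf P X^{\perp\perp}=\mathsf PX$ such that, for every $a\in|X|$, $u_a>0$ for some $u\in\mathsf PX$ and $\{u_a\mid u\in\mathsf PX\}$ is bounded. $\mathsf N$ is the PCS with web $\mathbb N$ and $\mathsf P\mathsf N=\{u\mid\sum_nu_n\le1\}$, with $e_n\in\mathsf P\mathsf N$ the $n$-th basis vector. $!X$ has web the set of finite multisets $\mu$ of elements of $|X|$, and $\mathsf P(!X)=\{u^!\mid u\in\mathsf PX\}^{\perp\perp}$ where $(u^!)_\mu=u^\mu=\prod_au_a^{\mu(a)}$. $X\multimap Y$ has web $|X|\times|Y|$, and $\mathsf P(X\multimap Y)=\{(u_av'_b)_{(a,b)}\mid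 u\in\mathsf PX,\ v'\in(\mathsf PY)^\perp\}^\perp$. A matrix $s$ indexed by $|!X|\times|Y|$ acts as the function $s(u)_b=\sum_\mu s_{\mu,b}u^\mu$; elements of $\mathsf P(!X\multimap Y)$ are determined by these functions. *Types* are $\sigma::=\mathsf{nat}\mid\sigma\Rightarrow\sigma$, with $[\![\mathsf{nat}]\!]=\mathsf N$ and $[\![\sigma\Rightarrow\tau]\!]={!}[\![\sigma]\!]\multimap[\![\tau]\!]$. *Terms* of probabilistic PCF are $M::=\underline n\mid x\mid\mathsf{succ}\,M\mid\mathsf{if}(M,P,[z]R)\mid\lambda x^\sigma M\mid MN\mid\mathsf{coin}(p)\mid\mathsf{fix}\,M$ with $p\in[0,1]\cap\mathbb Q$ and the usual simple typing ($z:\mathsf{nat}$ is bound in $R$; $\mathsf{fix}\,M:\sigma$ for $M:\sigma\Rightarrow\sigma$). A term $M:\sigma$ in a context $x_1:\sigma_1,\dots,x_k:\sigma_k$ is interpreted as the matrix (in several variables) characterized by $[\![x_i]\!](\vec u)=u_i$, $[\![\underline n]\!](\vec u)=e_n$, $[\![\mathsf{succ}\,M]\!](\vec u)=\sum_n[\![M]\!](\vec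 u)_n\,e_{n+1}$, $[\![\mathsf{if}(M,P,[z]R)]\!](\vec u)=[\![M]\!](\vec u)_0\,[\![P]\!](\vec u)+\sum_n[\![M]\!](\vec u)_{n+1}\,[\![R]\!](\vec u,e_n)$, $[\![\lambda x\,M]\!](\vec u)(v)=[\![M]\!](\vec u,v)$, $[\![MN]\!](\vec u)=[\![M]\!](\vec u)\bigl([\![N]\!](\vec u)\bigr)$, $[\![\mathsf{coin}(p)]\!](\vec u)=p\,e_0+(1-p)\,e_1$, and $[\![\mathsf{fix}\,M]\!](\vec u)=\sup_nf^n(0)$ for $f=[\![M]\!](\vec u)$. For $M$ closed, $[\![M]\!]\in\mathsf P[\![\sigma]\!]$. **Testing terms.** Let $\Omega_\sigma=\mathsf{fix}(\lambda x^\sigma x)$ and define closed terms * $\mathsf{Probe}_0=\lambda x\,\mathsf{if}(x,\underline0,[z]\Omega)$, $\ \mathsf{Probe}_{k+1}=\lambda x\,\mathsf{if}(x,\Omega,[z]\,\mathsf{Probe}_kz)$; * $\mathsf{Shift}_0=\lambda x\,x$, $\ \mathsf{Shift}_{k+1}=\lambda x\,\mathsf{if}(x,\Omega,[z]\,\mathsf{Shift}_kz)$,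 so that $[\![\mathsf{Shift}_k]\!](u)_i=u_{i+k}$; * $\mathsf{Prod}_0=\underline0$, $\ \mathsf{Prod}_{k+1}=\lambda x\,\mathsf{if}(x,\mathsf{Prod}_k,[z]\Omega)$; * $\mathsf{Choose}_0=\lambda\xi\,\Omega$, $\ \mathsf{Choose}_{k+1}=\lambda\xi\,\lambda x_1\cdots x_{k+1}\,\mathsf{if}(\xi,x_1,[\zeta]\,\mathsf{Choose}_k\,\zeta\,x_2\cdots x_{k+1})$. For $a\in|[\![\sigma]\!]|$ define numbers $|a|^+,|a|^-\in\mathbb N$ and closed terms $\mathsf P_a:\mathsf{nat}\Rightarrow\sigma$ and $\mathsf N_a:\mathsf{nat}\Rightarrow\sigma\Rightarrow\mathsf{nat}$ by induction on $\sigma$. For $\sigma=\mathsf{nat}$ and $a=n$: $|n|^+=|n|^-=0$, $\mathsf P_n=\lambda\xi\,\underline n$, $\mathsf N_n=\lambda\xi\,\mathsf{Probe}_n$. For $\sigma=\varphi\Rightarrow\psi$ and $a=([b_1,\dots,b_k],c)$: $$|a|^+=|c|^++\sum_{i=1}^k|b_i|^-,\qquad|a|^-=|c|^-+k+\sum_{i=1}^k|b_i|^+,$$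 $$\mathsf P_a=\lambda\xi\,\lambda x\;\mathsf{if}\bigl(\mathsf{Prod}_k\,B_1\cdots B_k,\ \mathsf P_c(\mathsf{Shift}_{|b_1|^-+\cdots+|b_k|^-}\,\xi),\ [z]\,\Omega_\psi\bigr),$$ where $B_1=\mathsf N_{b_1}\,\xi\,x$ and $B_i=\mathsf N_{b_i}(\mathsf{Shift}_{|b_1|^-+\cdots+|b_{i-1}|^-}\,\xi)\,x$ for $i\ge2$, and $$\mathsf N_a=\lambda\xi\,\lambda f\;\mathsf N_c\,(\mathsf{Shift}_{k+|b_1|^++\cdots+|b_k|^+}\,\xi)\,\bigl(f\,(\mathsf{Choose}_k\,\xi\,C_1\cdots C_k)\bigr),\qquad C_i=\mathsf P_{b_i}(\mathsf{Shift}_{k+|b_1|^++\cdots+|b_{i-1}|^+}\,\xi).$$ These terms depend on the order in which the elements of the multisets are enumerated; the statement holds for every choice of enumerations. **Theorem (Separation).** Let $\sigma$ be a type, $a\in|[\![\sigma]\!]|$, $n=|a|^-$, and let $w,w'\in\mathsf P[\![\sigma]\!]$ satisfy $w_a\ne w'_a$. Then there are rational numbers $q_0,\dots,q_{n-1}\ge0$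 such that $u=\sum_{i=0}^{n-1}q_ie_i$ belongs to $\mathsf P\mathsf N$ (that is, $\sum_iq_i\le1$) and $$[\![\mathsf N_a]\!](u)(w)\ne[\![\mathsf N_a]\!](u)(w').$$ -/

import Mathlib

open scoped ENNReal NNReal

noncomputable section

/-! ### Probabilistic coherence spaces -/

namespace PCoh

/-- The pairing `⟨u, u'⟩ = ∑ i, u i * u' i`, an element of `[0, ∞]`. -/
def pair {I : Type} (u u' : I → ℝ≥0) : ℝ≥0∞ := ∑' i, (u i : ℝ≥0∞) * (u' i : ℝ≥0∞)

/-- The orthogonal (polar) of a set of non-negative vectors. -/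
def orth {I : Type} (X : Set (I → ℝ≥0)) : Set (I → ℝ≥0) :=
  {u' | ∀ u ∈ X, pair u u' ≤ 1}

theorem pair_comm {I : Type} (u u' : I → ℝ≥0) : pair u u' = pair u' u := by
  unfold pair; exact tsum_congr fun i => mul_comm _ _

theorem subset_biorth {I : Type} (X : Set (I → ℝ≥0)) : X ⊆ orth (orth X) := by
  intro u hu u' hu'
  rw [pair_comm]; exact hu' u hu

theorem triorth {I : Type} (X : Set (I → ℝ≥0)) : orth (orth (orth X)) = orth X := by
  apply Set.Subset.antisymm
  · intro u hu v hv
    exact hu v (subset_biorth X hv)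
  · exact subset_biorth (orth X)

theorem mul_le_pair {I : Type} (u u' : I → ℝ≥0) (i : I) :
    ((u i * u' i : ℝ≥0) : ℝ≥0∞) ≤ pair u u' := by
  rw [ENNReal.coe_mul]
  exact ENNReal.le_tsum (f := fun i => (u i : ℝ≥0∞) * (u' i : ℝ≥0∞)) i

theorem pair_single {I : Type} [DecidableEq I] (u : I → ℝ≥0) (i : I) (r : ℝ≥0) :
    pair u (Pi.single i r) = ((u i * r : ℝ≥0) : ℝ≥0∞) := by
  unfold pair
  rw [tsum_eq_single i]
  · simp
  · intro j hj; simp [Pi.single_eq_of_ne hj]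

/-- A probabilistic coherence space: a countable web together with a set of non-negative
vectors equal to its bi-orthogonal, in which every coordinate is somewhere positive, and
bounded. -/
structure PCS where
  web : Type
  countable_web : Countable web
  P : Set (web → ℝ≥0)
  biorth : orth (orth P) = P
  exists_pos : ∀ a, ∃ u ∈ P, 0 < u a
  bounded : ∀ a, ∃ A : ℝ≥0, 0 < A ∧ ∀ u ∈ P, u a ≤ A

/-- In the orthogonal, too, every coordinate is somewhere positive. -/
theorem PCS.orth_exists_pos (X : PCS) (a : X.web) : ∃ u ∈ orth X.P, 0 < u a := by
  classical
  obtain ⟨A, hA, h⟩ := X.bounded a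
  refine ⟨Pi.single a A⁻¹, fun u hu => ?_, by simpa using hA⟩
  rw [pair_single]
  have : u a * A⁻¹ ≤ 1 := by
    rw [← div_eq_mul_inv]; exact div_le_one_of_le₀ (h u hu) hA.le
  exact_mod_cast this

/-- In the orthogonal, too, every coordinate is bounded. -/
theorem PCS.orth_bounded (X : PCS) (a : X.web) :
    ∃ A : ℝ≥0, 0 < A ∧ ∀ u ∈ orth X.P, u a ≤ A := by
  obtain ⟨v, hv, hpos⟩ := X.exists_pos a
  refine ⟨(v a)⁻¹, by simpa using hpos, fun u hu => ?_⟩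
  have h := (mul_le_pair v u a).trans (hu v hv)
  have h' : v a * u a ≤ 1 := by exact_mod_cast h
  rw [← one_div, le_div_iff₀ hpos, mul_comm]
  exact h'

/-- The space of natural numbers: `P` is the set of sub-probability distributions on `ℕ`. -/
abbrev natPCS : PCS where
  web := ℕ
  countable_web := inferInstance
  P := {u | ∑' n, (u n : ℝ≥0∞) ≤ 1}
  biorth := by
    apply Set.Subset.antisymm _ (subset_biorth _)
    intro u hu
    have h1 : (fun _ => 1 : ℕ → ℝ≥0) ∈ orth {u : ℕ → ℝ≥0 | ∑' n, (u n : ℝ≥0∞) ≤ 1} := by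
      intro v hv
      simpa [pair] using hv
    simpa [pair] using hu _ h1
  exists_pos := fun a => ⟨Pi.single a 1, by
    show ∑' n, ((Pi.single a 1 : ℕ → ℝ≥0) n : ℝ≥0∞) ≤ 1
    rw [tsum_eq_single a (fun b hb => by simp [Pi.single_eq_of_ne hb])]
    simp, by simp⟩
  bounded := fun a => ⟨1, one_pos, fun u hu => by
    have h := (ENNReal.le_tsum (f := fun n => (u n : ℝ≥0∞)) a).trans hu
    exact_mod_cast h⟩

/-- The tensor `(u ⊗ v) (a, b) = u a * v b` of two vectors. -/
def tens {I J : Type} (u : I → ℝ≥0) (v : J → ℝ≥0) : I × J → ℝ≥0 := fun p => u p.1 * v p.2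

/-- The space `X ⊸ Y = (X ⊗ Y^⊥)^⊥` of linear morphisms: a matrix `t` belongs to it when
`∑ (a, b), t (a, b) * u a * v' b ≤ 1` for all `u ∈ P X` and `v' ∈ (P Y)^⊥`. -/
abbrev limpl (X Y : PCS) : PCS where
  web := X.web × Y.web
  countable_web := by
    have := X.countable_web
    have := Y.countable_web
    infer_instance
  P := orth {s | ∃ u ∈ X.P, ∃ v ∈ orth Y.P, s = tens u v}
  biorth := triorth _
  exists_pos := by
    classical
    rintro ⟨a, b⟩
    obtain ⟨A, hA, hA'⟩ := X.bounded a
    obtain ⟨B, hB, hB'⟩ := Y.orth_bounded b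
    refine ⟨Pi.single (a, b) (A * B)⁻¹, ?_, by
      simpa using ⟨hB, hA⟩⟩
    rintro s ⟨u, hu, v, hv, rfl⟩
    have hp := pair_single (tens u v) (a, b) (A * B)⁻¹
    refine hp.trans_le ?_
    have : tens u v (a, b) * (A * B)⁻¹ ≤ 1 := by
      rw [← div_eq_mul_inv]
      exact div_le_one_of_le₀ (mul_le_mul' (hA' u hu) (hB' v hv)) (mul_pos hA hB).le
    exact_mod_cast this
  bounded := by
    rintro ⟨a, b⟩
    obtain ⟨u, hu, hua⟩ := X.exists_pos a
    obtain ⟨v, hv, hvb⟩ := Y.orth_exists_pos b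
    have hp : 0 < tens u v (a, b) := mul_pos hua hvb
    refine ⟨(tens u v (a, b))⁻¹, by simpa using hp, fun t ht => ?_⟩
    have h := (mul_le_pair (tens u v) t (a, b)).trans (ht _ ⟨u, hu, v, hv, rfl⟩)
    have h' : tens u v (a, b) * t (a, b) ≤ 1 := by exact_mod_cast h
    rw [← one_div, le_div_iff₀ hp, mul_comm]
    exact h'

/-- The promotion `u^!` of a vector: `(u^!) μ = ∏ a, u a ^ μ a` for a finite multiset `μ`.
Finite multisets of elements of `I` are functions `I → ℕ` with finite support. -/
def prom {I : Type} (u : I → ℝ≥0) : (I →₀ ℕ) → ℝ≥0 := fun μ => μ.prod fun a k => u a ^ k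

theorem PCS.mid_mem (X : PCS) {u v : X.web → ℝ≥0} (hu : u ∈ X.P) (hv : v ∈ X.P) :
    (fun a => u a / 2 + v a / 2) ∈ X.P := by
  rw [← X.biorth]
  intro w hw
  have e : ∀ a : X.web, (w a : ℝ≥0∞) * ((u a / 2 + v a / 2 : ℝ≥0) : ℝ≥0∞)
      = ((u a : ℝ≥0∞) * w a) * 2⁻¹ + ((v a : ℝ≥0∞) * w a) * 2⁻¹ := by
    intro a
    rw [div_eq_mul_inv, div_eq_mul_inv]
    push_cast
    ring
  have hu' := hw u hu
  have hv' := hw v hv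
  unfold pair at hu' hv' ⊢
  rw [tsum_congr e, ENNReal.tsum_add, ENNReal.tsum_mul_right, ENNReal.tsum_mul_right]
  calc _ ≤ 1 * (2 : ℝ≥0∞)⁻¹ + 1 * 2⁻¹ := by gcongr
    _ = 1 := by rw [one_mul, ENNReal.inv_two_add_inv_two]

theorem PCS.exists_pos_on (X : PCS) (μ : X.web →₀ ℕ) :
    ∃ u ∈ X.P, ∀ a ∈ μ.support, 0 < u a := by
  classical
  induction μ.support using Finset.induction_on with
  | empty =>
    refine ⟨fun _ => 0, ?_, by simp⟩
    rw [← X.biorth]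
    intro w _
    simp [pair]
  | insert a s _ ih =>
    obtain ⟨u, hu, hu'⟩ := ih
    obtain ⟨v, hv, hv'⟩ := X.exists_pos a
    refine ⟨_, X.mid_mem hu hv, fun b hb => ?_⟩
    rcases Finset.mem_insert.1 hb with rfl | hb
    · exact add_pos_of_nonneg_of_pos zero_le (half_pos hv')
    · exact add_pos_of_pos_of_nonneg (half_pos (hu' b hb)) zero_le

/-- The exponential `!X`: its web consists of the finite multisets of points of `X`, and
`P (!X)` is the bi-orthogonal of the set of all promotions `u^!`, `u ∈ P X`. -/
abbrev excl (X : PCS) : PCS where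
  web := X.web →₀ ℕ
  countable_web := by
    have := X.countable_web
    infer_instance
  P := orth (orth {s | ∃ u ∈ X.P, s = prom u})
  biorth := triorth _
  exists_pos := by
    intro μ
    obtain ⟨u, hu, hpos⟩ := X.exists_pos_on μ
    exact ⟨prom u, subset_biorth _ ⟨u, hu, rfl⟩,
      Finset.prod_pos fun a ha => pow_pos (hpos a ha) _⟩
  bounded := by
    classical
    intro μ
    choose A hA hA' using X.bounded
    have hB : 0 < prom A μ := Finset.prod_pos fun a _ => pow_pos (hA a) _
    refine ⟨prom A μ, hB, fun U hU => ?_⟩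
    have ht : (Pi.single μ (prom A μ)⁻¹ : (X.web →₀ ℕ) → ℝ≥0) ∈
        orth {s | ∃ u ∈ X.P, s = prom u} := by
      rintro s ⟨u, hu, rfl⟩
      refine (pair_single (prom u) μ (prom A μ)⁻¹).trans_le ?_
      have : prom u μ * (prom A μ)⁻¹ ≤ 1 := by
        rw [← div_eq_mul_inv]
        exact div_le_one_of_le₀ (Finset.prod_le_prod' fun a _ =>
          pow_le_pow_left' (hA' a u hu) _) hB.le
      exact_mod_cast this
    have h := hU _ ht
    have h2 := (pair_single U μ (prom A μ)⁻¹).symm.trans_le ((pair_comm _ _).trans_le h)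
    have h' : U μ * (prom A μ)⁻¹ ≤ 1 := by exact_mod_cast h2
    rwa [← div_eq_mul_inv, div_le_iff₀ hB, one_mul] at h'

/-- The function `[0,∞]^I → [0,∞]^J` described by a matrix `s` with rows indexed by finite
multisets: `(s u) b = ∑ μ, s (μ, b) * ∏ a, u a ^ μ a`. Sums are taken in `[0, ∞]`, so they
always make sense. -/
def funApp {I J : Type} (s : (I →₀ ℕ) × J → ℝ≥0∞) (u : I → ℝ≥0∞) : J → ℝ≥0∞ :=
  fun b => ∑' μ : I →₀ ℕ, s (μ, b) * μ.prod fun a k => u a ^ k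

end PCoh

/-! ### Probabilistic PCF -/

namespace PPCF

open PCoh

inductive Ty : Type
  | nat : Ty
  | arr : Ty → Ty → Ty

/-- The interpretation of types: `⟦nat⟧` is the space of natural numbers, and
`⟦σ → τ⟧ = !⟦σ⟧ ⊸ ⟦τ⟧`. -/
@[reducible] def Ty.interp : Ty → PCS
  | .nat => natPCS
  | .arr σ τ => limpl (excl σ.interp) τ.interp

/-- The web of `⟦σ⟧`: `ℕ` for `nat`, pairs `(μ, b)` of a finite multiset and a point for an
arrow type. -/
abbrev Ty.Web (σ : Ty) : Type := σ.interp.web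

/-- `Var Γ σ`: the variables of type `σ` in the typing context `Γ` (de Bruijn indices; the last
declared variable is the head of the list). -/
inductive Var : List Ty → Ty → Type
  | zero {Γ : List Ty} {σ : Ty} : Var (σ :: Γ) σ
  | succ {Γ : List Ty} {σ τ : Ty} : Var Γ σ → Var (τ :: Γ) σ

/-- `Tm Γ σ`: the terms `M` with `Γ ⊢ M : σ`, up to renaming of bound variables. The constructor
`ifz M P R` is `if(M, P, [z] R)`, where `z : nat` is bound in `R`; `dice p` is a coin giving
`0` with probability `p` and `1` with probability `1 - p`. -/
inductive Tm : List Ty → Ty → Type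
  | var {Γ : List Ty} {σ : Ty} : Var Γ σ → Tm Γ σ
  | num {Γ : List Ty} : ℕ → Tm Γ .nat
  | succ {Γ : List Ty} : Tm Γ .nat → Tm Γ .nat
  | ifz {Γ : List Ty} {σ : Ty} : Tm Γ .nat → Tm Γ σ → Tm (.nat :: Γ) σ → Tm Γ σ
  | lam {Γ : List Ty} (σ : Ty) {τ : Ty} : Tm (σ :: Γ) τ → Tm Γ (.arr σ τ)
  | app {Γ : List Ty} {σ τ : Ty} : Tm Γ (.arr σ τ) → Tm Γ σ → Tm Γ τ
  | dice {Γ : List Ty} (p : ℚ) : 0 ≤ p → p ≤ 1 → Tm Γ .nat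
  | fix {Γ : List Ty} {σ : Ty} : Tm Γ (.arr σ σ) → Tm Γ σ

/-! ### Interpretation of terms -/

/-- The web of the product `⟦σ₁⟧ & ⋯ & ⟦σₖ⟧` interpreting a context: the disjoint union of
the webs. -/
def CtxWeb : List Ty → Type
  | [] => Empty
  | σ :: Γ => σ.Web ⊕ CtxWeb Γ

def Var.inj : {Γ : List Ty} → {σ : Ty} → Var Γ σ → σ.Web → CtxWeb Γ
  | _, _, .zero, a => Sum.inl a
  | _, _, .succ x, a => Sum.inr (x.inj a)

/-- Matrices `(!⟦Γ⟧) × J → [0, ∞]`. The `b`-th column of such a matrix is read as the power series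
whose coefficient at a finite multiset `d` is the entry at `(d, b)`. -/
abbrev Mat (Γ : List Ty) (J : Type) : Type := J → MvPowerSeries (CtxWeb Γ) ℝ≥0∞

/-- Application of `f : !⟦Γ⟧ ⊸ (!X ⊸ Y)` to the promotion of `g : !⟦Γ⟧ ⊸ X`:
`b ↦ ∑ m, f (m, b) * ∏ a, (g a) ^ m a`, where products are products of power series and the sum
is taken coefficient by coefficient. The coefficient at `d` is thus the sum over all
`m = [a₁, …, aₙ]` and all `d = d₀ + d₁ + ⋯ + dₙ` of `f (d₀, (m, b)) * ∏ i, g (dᵢ, aᵢ)`. -/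
def kapp {Γ : List Ty} {I J : Type} (f : Mat Γ ((I →₀ ℕ) × J)) (g : Mat Γ I) : Mat Γ J :=
  fun b d => ∑' m : I →₀ ℕ, MvPowerSeries.coeff d (f (m, b) * m.prod fun a k => g a ^ k)

/-- The series `f (e_n, u)` in `u`, obtained from a series `f` over the context `Γ, z : nat` by
setting `z` to the `n`-th basis vector: the coefficient at `d` is the sum of the coefficients of
`f` at all multisets consisting of `d` and `k` copies of `n` (a point of the web of `z`). -/
def atNum {Γ : List Ty} (n : ℕ) (f : MvPowerSeries (CtxWeb (.nat :: Γ)) ℝ≥0∞) :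
    MvPowerSeries (CtxWeb Γ) ℝ≥0∞ :=
  fun d => ∑' k : ℕ, MvPowerSeries.coeff
    (Finsupp.sumElim (Finsupp.single (n : Ty.nat.Web) k) d : CtxWeb (.nat :: Γ) →₀ ℕ) f

/-- The interpretation `⟦M⟧_Γ`, a matrix `(!⟦Γ⟧) × ⟦σ⟧ → [0, ∞]`, by induction on the typing
derivation of `M`. As functions of `u` (and `v`) these are:
`⟦x⟧ u = u x`, `⟦num n⟧ u = e_n`, `⟦succ M⟧ u = ∑ n, (⟦M⟧ u)_n e_{n+1}`,
`⟦if(M, P, [z]R)⟧ u = (⟦M⟧ u)_0 ⟦P⟧ u + ∑ n, (⟦M⟧ u)_{n+1} ⟦R⟧ (u, e_n)`,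
`⟦λ x, M⟧ u v = ⟦M⟧ (u, v)`, `⟦M N⟧ u = ⟦M⟧ u (⟦N⟧ u)`, `⟦dice p⟧ u = p e_0 + (1 - p) e_1`,
and `⟦fix M⟧ u = sup_n (⟦M⟧ u)^n 0`. -/
def Tm.sem : {Γ : List Ty} → {σ : Ty} → Tm Γ σ → Mat Γ σ.Web
  | _, _, .var x => fun a => MvPowerSeries.X (x.inj a)
  | _, _, .num n => fun k : ℕ => if k = n then 1 else 0
  | _, _, .succ M => fun k : ℕ =>
      match k with
      | 0 => 0
      | j + 1 => M.sem (j : ℕ)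
  | _, _, .ifz M P R => fun a d => MvPowerSeries.coeff d (M.sem (0 : ℕ) * P.sem a) +
      ∑' n : ℕ, MvPowerSeries.coeff d (M.sem (n + 1 : ℕ) * atNum n (R.sem a))
  | _, _, .lam _ M => fun p d => MvPowerSeries.coeff (Finsupp.sumElim p.1 d) (M.sem p.2)
  | _, _, .app M N => kapp M.sem N.sem
  | _, _, .dice p _ _ => fun k : ℕ =>
      if k = 0 then MvPowerSeries.C (ENNReal.ofReal p)
      else if k = 1 then MvPowerSeries.C (ENNReal.ofReal (1 - p)) else 0
  | _, _, .fix M => fun a d => ⨆ n : ℕ, MvPowerSeries.coeff d ((kapp M.sem)^[n] (fun _ => 0) a)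

/-- The interpretation of a closed term, a vector indexed by the web of its type. -/
def Tm.csem {σ : Ty} (M : Tm [] σ) : σ.Web → ℝ≥0∞ := fun a => MvPowerSeries.coeff 0 (M.sem a)

/-! ### Auxiliary terms

They are closed; a closed term is given here in every context `Γ`. -/

/-- The ever-looping term `fix (λ x, x)`. -/
def omega {Γ : List Ty} (σ : Ty) : Tm Γ σ := .fix (.lam σ (.var .zero))

/-- `Probe_0 = λ x, if(x, 0, [z] Ω)` and `Probe_{k+1} = λ x, if(x, Ω, [z] Probe_k z)`. -/
def probe : (k : ℕ) → {Γ : List Ty} → Tm Γ (.arr .nat .nat)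
  | 0, _ => .lam .nat (.ifz (.var .zero) (.num 0) (omega .nat))
  | k + 1, _ => .lam .nat (.ifz (.var .zero) (omega .nat) (.app (probe k) (.var .zero)))

/-- `Shift_0 = λ x, x` and `Shift_{k+1} = λ x, if(x, Ω, [z] Shift_k z)`. As a function on
sub-probability distributions, `Shift_k u = (u_k, u_{k+1}, …)`. -/
def shift : (k : ℕ) → {Γ : List Ty} → Tm Γ (.arr .nat .nat)
  | 0, _ => .lam .nat (.var .zero)
  | k + 1, _ => .lam .nat (.ifz (.var .zero) (omega .nat) (.app (shift k) (.var .zero)))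

/-- The type `σ^k → τ`. -/
def Ty.pow (σ : Ty) : ℕ → Ty → Ty
  | 0, τ => τ
  | k + 1, τ => .arr σ (σ.pow k τ)

/-- The context `Γ, x₁ : σ, …, xₖ : σ`. -/
def extN (σ : Ty) : ℕ → List Ty → List Ty
  | 0, Γ => Γ
  | k + 1, Γ => extN σ k (σ :: Γ)

/-- A variable of `Γ`, seen in `Γ, x₁ : σ, …, xₖ : σ`. -/
def Var.lift {σ τ : Ty} : (k : ℕ) → {Γ : List Ty} → Var Γ τ → Var (extN σ k Γ) τ
  | 0, _, x => x
  | k + 1, _, x => Var.lift k (.succ x)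

/-- The variable `x_{i+1}` of `Γ, x₁ : σ, …, xₖ : σ`. -/
def Var.nth {σ : Ty} : (k : ℕ) → {Γ : List Ty} → Fin k → Var (extN σ k Γ) σ
  | 0, _, i => i.elim0
  | k + 1, _, i => Fin.cases (Var.lift k .zero) (fun j => Var.nth k j) i

/-- `λ x₁ … xₖ, M`. -/
def Tm.lamN (σ : Ty) {τ : Ty} : (k : ℕ) → {Γ : List Ty} → Tm (extN σ k Γ) τ → Tm Γ (σ.pow k τ)
  | 0, _, M => M
  | k + 1, _, M => .lam σ (Tm.lamN σ k M)

/-- `M N₁ … Nₖ`. -/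
def Tm.appN {σ τ : Ty} {Γ : List Ty} : (k : ℕ) → Tm Γ (σ.pow k τ) → (Fin k → Tm Γ σ) → Tm Γ τ
  | 0, M, _ => M
  | k + 1, M, N => Tm.appN k (.app M (N 0)) (fun i => N i.succ)

/-- `Prod_0 = 0` and `Prod_{k+1} = λ x, if(x, Prod_k, [z] Ω)`. -/
def pprod : (k : ℕ) → {Γ : List Ty} → Tm Γ (Ty.nat.pow k .nat)
  | 0, _ => .num 0
  | k + 1, _ => .lam .nat (.ifz (.var .zero) (pprod k) (omega _))

/-- `Choose_0 = λ ξ, Ω` and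
`Choose_{k+1} = λ ξ x₁ … x_{k+1}, if(ξ, x₁, [ζ] Choose_k ζ x₂ … x_{k+1})`. -/
def pchoose (σ : Ty) : (k : ℕ) → {Γ : List Ty} → Tm Γ (.arr .nat (σ.pow k σ))
  | 0, _ => .lam .nat (omega σ)
  | k + 1, _ => .lam .nat (Tm.lamN σ (k + 1)
      (.ifz (.var (Var.lift (k + 1) .zero))
        (.var (Var.nth (k + 1) 0))
        (Tm.appN k (.app (pchoose σ k) (.var .zero))
          (fun i => .var (.succ (Var.nth (k + 1) i.succ))))))

/-! ### Testing terms -/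

mutual

/-- `|n|⁺ = 0` and `|([b₁, …, bₖ], c)|⁺ = |c|⁺ + ∑ i, |bᵢ|⁻`. -/
def plen : (σ : Ty) → σ.Web → ℕ
  | .nat, _ => 0
  | .arr φ ψ, a => plen ψ a.2 + Finsupp.sum a.1 (fun b k => k * nlen φ b)

/-- `|n|⁻ = 0` and `|([b₁, …, bₖ], c)|⁻ = |c|⁻ + k + ∑ i, |bᵢ|⁺`. -/
def nlen : (σ : Ty) → σ.Web → ℕ
  | .nat, _ => 0
  | .arr φ ψ, a => nlen ψ a.2 + Finsupp.sum a.1 (fun _ k => k)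
      + Finsupp.sum a.1 (fun b k => k * plen φ b)

end

/-- Points of the web of `⟦σ⟧` written out with lists in place of multisets, that is, together
with a choice, for each multiset involved, of an enumeration `b₁, …, bₖ` of it. -/
def Enum : Ty → Type
  | .nat => ℕ
  | .arr φ ψ => List (Enum φ) × Enum ψ

/-- The point of the web so written: `([b₁, …, bₖ], c)` for `((b₁, …, bₖ), c)`. -/
def Enum.point : (σ : Ty) → Enum σ → σ.Web
  | .nat, n => n
  | .arr φ ψ, e =>
      ((List.map (fun b => Finsupp.single (Enum.point φ b) 1) e.1).sum, Enum.point ψ e.2)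

theorem Enum.point_surjective : (σ : Ty) → Function.Surjective (Enum.point σ)
  | .nat => fun n => ⟨n, rfl⟩
  | .arr φ ψ => by
    rintro ⟨m, c⟩
    obtain ⟨c', hc⟩ := Enum.point_surjective ψ c
    have key : ∀ m : φ.Web →₀ ℕ, ∃ l : List (Enum φ),
        (l.map fun b => Finsupp.single (Enum.point φ b) 1).sum = m := by
      intro m
      induction m using Finsupp.induction_linear with
      | zero => exact ⟨[], rfl⟩
      | add f g hf hg =>
        obtain ⟨l, rfl⟩ := hf
        obtain ⟨l', rfl⟩ := hg
        exact ⟨l ++ l', by simp⟩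
      | single b k =>
        obtain ⟨b', rfl⟩ := Enum.point_surjective φ b
        exact ⟨List.replicate k b', by simp⟩
    obtain ⟨l, hl⟩ := key m
    exact ⟨(l, c'), Prod.ext hl hc⟩

/-- `Shift_k M`, except that the first element of an argument list uses `M` itself. -/
def shiftFrom {Γ : List Ty} {k : ℕ} (i : Fin k) (n : ℕ) (M : Tm Γ .nat) : Tm Γ .nat :=
  if (i : ℕ) = 0 then M else .app (shift n) M

mutual

/-- The term `P_a : nat → σ`, for `a` with chosen enumerations:
`P_n = λ ξ, n`, and, for `a = ([b₁, …, bₖ], c)`,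
`P_a = λ ξ x, if(Prod_k (N_{b₁} ξ x) (N_{b₂} (Shift_{|b₁|⁻} ξ) x) …
  (N_{bₖ} (Shift_{|b₁|⁻ + ⋯ + |b_{k-1}|⁻} ξ) x), P_c (Shift_{|b₁|⁻ + ⋯ + |bₖ|⁻} ξ), [z] Ω)`. -/
def ptest : (σ : Ty) → Enum σ → {Γ : List Ty} → Tm Γ (.arr .nat σ)
  | .nat, (n : ℕ), _ => .lam .nat (.num n)
  | .arr φ ψ, (e : List (Enum φ) × Enum ψ), _ =>
      .lam .nat (.lam φ (.ifz
        (Tm.appN e.1.length (pprod e.1.length) fun i =>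
          .app
            (.app (ntest φ (e.1.get i))
              (shiftFrom i ((e.1.take i).map fun b => nlen φ b.point).sum (.var (.succ .zero))))
            (.var .zero))
        (.app (ptest ψ e.2)
          (.app (shift (e.1.map fun b => nlen φ b.point).sum) (.var (.succ .zero))))
        (omega ψ)))

/-- The testing term `N_a : nat → σ → nat`, for `a` with chosen enumerations:
`N_n = λ ξ, Probe_n`, and, for `a = ([b₁, …, bₖ], c)`,
`N_a = λ ξ f, N_c (Shift_{k + |b₁|⁺ + ⋯ + |bₖ|⁺} ξ) (f (Choose_k ξ (P_{b₁} (Shift_k ξ)) …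
  (P_{bₖ} (Shift_{k + |b₁|⁺ + ⋯ + |b_{k-1}|⁺} ξ))))`. -/
def ntest : (σ : Ty) → Enum σ → {Γ : List Ty} → Tm Γ (.arr .nat (.arr σ .nat))
  | .nat, (n : ℕ), _ => .lam .nat (probe n)
  | .arr φ ψ, (e : List (Enum φ) × Enum ψ), _ =>
      .lam .nat (.lam (.arr φ ψ)
        (.app
          (.app (ntest ψ e.2)
            (.app (shift (e.1.length + (e.1.map fun b => plen φ b.point).sum))
              (.var (.succ .zero))))
          (.app (.var .zero)
            (Tm.appN e.1.length (.app (pchoose φ e.1.length) (.var (.succ .zero))) fun i =>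
              .app (ptest φ (e.1.get i))
                (.app (shift (e.1.length + ((e.1.take i).map fun b => plen φ b.point).sum))
                  (.var (.succ .zero)))))))

end

end PPCF

end

noncomputable section

/-! ### Semirings with infinite sums, and evaluation of power series in them -/

namespace PCoh

-- For fixed parameters `u`, coordinate `0` of `N_a u` is a linear form on `⟦σ⟧` and `P_a u` is a
-- vector, with explicit entries `nsem` and `psem`. For `a = ([b₁, …, bₖ], c)`, the form `N_a u`
-- evaluates `w` at the combination `∑ uᵢ • P_{bᵢ}` and applies `N_c` to the result, while `P_a u`
-- sends `x` to `(∏ N_{bᵢ} x) • P_c`; all subtests use disjoint blocks of parameters.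
-- `tev_ptest_ntest` proves that these are the values of the terms.
--
-- Separation is proved in contrapositive form (`Sep`): two vectors with the same finite pairing
-- against the test for all small rational parameters agree at `a`. The induction on types treats
-- `P` and `N` together (`sep_loc_psem_nsem`). As the blocks are disjoint (`Loc`), one subtest can
-- be varied while the others stay fixed, and the induction hypotheses are applied one block at a
-- time. For `P_a` this peels off the linear forms in turn (`sep_prodL`). For `N_a` the coefficient
-- of a power series at `[b₁, …, bₖ]` has to be recovered from its values at small combinations of
-- the `P_{bᵢ}`. The directional derivative along `P_{b₁}` is a pairing of `P_{b₁}` with the partial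
-- derivatives, so the induction hypothesis isolates the derivative at `b₁`; iterating and
-- evaluating at `0` gives the coefficient times a nonzero integer (`eqFin_of_val_mixL`).
--
-- Subtraction is not available in `[0, ∞]`, so every equality is carried along with finiteness
-- (`EqFin`). The initial finiteness comes from `psem_nsem_bound`: the tests take values at most `1`
-- on the coherence space.

/-- The power series with given coefficients. -/
def mkSeries {R : Type} {A : Type} (c : (A →₀ ℕ) → R) : MvPowerSeries A R := c

theorem coeff_mkSeries {R : Type} [Semiring R] {A : Type} (c : (A →₀ ℕ) → R) (k : A →₀ ℕ) :
    MvPowerSeries.coeff k (mkSeries c) = c k := rfl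

/-- Commutative `[0, ∞]`-algebras with arbitrary infinite sums, over which multiplication
distributes. -/
class InfSum (R : Type) [CommSemiring R] [Algebra ℝ≥0∞ R] where
  isum : {ι : Type} → (ι → R) → R
  isum_add {ι : Type} (f g : ι → R) : isum (fun i => f i + g i) = isum f + isum g
  isum_mul_left {ι : Type} (r : R) (f : ι → R) : isum (fun i => r * f i) = r * isum f
  isum_prod {ι κ : Type} (f : ι → κ → R) :
    isum (fun p : ι × κ => f p.1 p.2) = isum fun i => isum fun k => f i k
  isum_inj {ι κ : Type} {g : κ → ι} (hg : Function.Injective g) (f : ι → R)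
    (hf : ∀ i, i ∉ Set.range g → f i = 0) : isum (fun k => f (g k)) = isum f
  isum_unit (r : R) : isum (fun _ : Unit => r) = r
  algebraMap_isum {ι : Type} (f : ι → ℝ≥0∞) :
    algebraMap ℝ≥0∞ R (∑' i, f i) = isum fun i => algebraMap ℝ≥0∞ R (f i)

namespace InfSum

instance : InfSum ℝ≥0∞ where
  isum f := ∑' i, f i
  isum_add _ _ := ENNReal.tsum_add
  isum_mul_left _ _ := ENNReal.tsum_mul_left
  isum_prod _ := ENNReal.tsum_prod
  isum_inj hg f hf := hg.tsum_eq fun i hi => by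
    by_contra h
    exact hi (hf i h)
  isum_unit r := by simp
  algebraMap_isum _ := rfl

theorem isum_ennreal {ι : Type} (f : ι → ℝ≥0∞) : isum f = ∑' i, f i := rfl

variable {R : Type} [CommSemiring R] [Algebra ℝ≥0∞ R] [InfSum R]

theorem isum_zero {ι : Type} : isum (fun _ : ι => (0 : R)) = 0 := by
  have := isum_mul_left (0 : R) (fun _ : ι => (0 : R))
  simpa using this

theorem isum_mul_right {ι : Type} (f : ι → R) (r : R) :
    isum (fun i => f i * r) = isum f * r := by
  simp_rw [mul_comm _ r]; exact isum_mul_left r f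

theorem isum_single {ι : Type} (i : ι) (f : ι → R) (hf : ∀ j, j ≠ i → f j = 0) :
    isum f = f i := by
  rw [← isum_inj (g := fun _ : Unit => i) (fun _ _ _ => rfl) f
    (fun j hj => hf j fun h => hj ⟨(), h.symm⟩), isum_unit]

theorem isum_ite {ι : Type} [DecidableEq ι] (i : ι) (f : ι → R) :
    isum (fun j => if j = i then f j else 0) = f i := by
  rw [isum_single i _ (fun j hj => if_neg hj), if_pos rfl]

theorem isum_equiv {ι κ : Type} (e : κ ≃ ι) (f : ι → R) : isum (fun k => f (e k)) = isum f :=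
  isum_inj e.injective f fun i hi => (hi (e.surjective i)).elim

theorem isum_comm {ι κ : Type} (f : ι → κ → R) :
    isum (fun i => isum fun k => f i k) = isum fun k => isum fun i => f i k := by
  rw [← isum_prod, ← isum_prod,
    ← isum_equiv (Equiv.prodComm κ ι) (fun p : ι × κ => f p.1 p.2)]
  rfl

theorem isum_finset_sum {ι κ : Type} (s : Finset κ) (f : κ → ι → R) :
    isum (fun i => ∑ k ∈ s, f k i) = ∑ k ∈ s, isum (f k) := by
  classical
  induction s using Finset.induction_on with
  | empty => simp [isum_zero]
  | insert a s ha ih => simp only [Finset.sum_insert ha, isum_add, ih]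

theorem finset_sum_eq_isum {ι : Type} [DecidableEq ι] (s : Finset ι) (f : ι → R) :
    ∑ i ∈ s, f i = isum fun i => if i ∈ s then f i else 0 := by
  have h : (fun i => if i ∈ s then f i else 0) = fun i => ∑ k ∈ s, if i = k then f i else 0 := by
    funext i; simp
  rw [h, isum_finset_sum]
  exact Finset.sum_congr rfl fun k _ => (isum_ite k f).symm

/-- Grouping pairs by their sum. This turns the Cauchy product of coefficients into a double sum,
which makes `ev` multiplicative. -/
theorem isum_antidiagonal {M : Type} [AddMonoid M] [DecidableEq M] [Finset.HasAntidiagonal M]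
    (F : M → M → M → R) :
    isum (fun m => ∑ p ∈ Finset.HasAntidiagonal.antidiagonal m, F m p.1 p.2)
      = isum fun i => isum fun j => F (i + j) i j := by
  simp_rw [finset_sum_eq_isum, Finset.HasAntidiagonal.mem_antidiagonal]
  rw [isum_comm, isum_prod (fun i j => isum fun m => if i + j = m then F m i j else 0)]
  congr! with i j
  simp_rw [eq_comm (a := i + j)]
  exact isum_ite (i + j) fun m => F m i j

instance (A : Type) : InfSum (MvPowerSeries A R) where
  isum f := mkSeries fun k => isum fun i => MvPowerSeries.coeff k (f i)
  isum_add f g := by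
    ext k
    simp only [coeff_mkSeries, map_add, isum_add]
  isum_mul_left r f := by
    classical
    ext k
    simp only [coeff_mkSeries, MvPowerSeries.coeff_mul, isum_finset_sum, isum_mul_left]
  isum_prod f := by
    ext k
    exact isum_prod fun i j => MvPowerSeries.coeff k (f i j)
  isum_inj hg f hf := by
    ext k
    exact isum_inj hg (fun i => MvPowerSeries.coeff k (f i)) fun i hi => by rw [hf i hi, map_zero]
  isum_unit r := by
    ext k
    exact isum_unit _
  algebraMap_isum f := by
    classical
    ext k
    simp only [coeff_mkSeries, MvPowerSeries.algebraMap_apply, MvPowerSeries.coeff_C]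
    split_ifs
    · exact algebraMap_isum f
    · exact isum_zero.symm

theorem coeff_isum {A ι : Type} (f : ι → MvPowerSeries A R) (k : A →₀ ℕ) :
    MvPowerSeries.coeff k (isum f) = isum fun i => MvPowerSeries.coeff k (f i) := rfl

end InfSum

open InfSum

/-- The monomial `u ^ μ = ∏ a, u a ^ μ a`. -/
def mon {R : Type} [CommSemiring R] {I : Type} (u : I → R) (μ : I →₀ ℕ) : R :=
  μ.prod fun a k => u a ^ k

section mon

variable {R : Type} [CommSemiring R] {I J : Type}

theorem mon_zero (u : I → R) : mon u 0 = 1 := Finsupp.prod_zero_index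

theorem mon_add (u : I → R) (μ ν : I →₀ ℕ) : mon u (μ + ν) = mon u μ * mon u ν := by
  classical
  exact Finsupp.prod_add_index' (fun _ => pow_zero _) fun _ _ _ => pow_add _ _ _

theorem mon_single (u : I → R) (a : I) (k : ℕ) : mon u (Finsupp.single a k) = u a ^ k :=
  Finsupp.prod_single_index (pow_zero _)

theorem mon_sumElim (u : I → R) (v : J → R) (μ : I →₀ ℕ) (ν : J →₀ ℕ) :
    mon (Sum.elim u v) (Finsupp.sumElim μ ν) = mon u μ * mon v ν :=
  Finsupp.prod_sumElim _ _ _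

theorem map_mon {S F : Type} [CommSemiring S] [FunLike F R S] [MonoidHomClass F R S] (f : F)
    (u : I → R) (μ : I →₀ ℕ) : f (mon u μ) = mon (fun a => f (u a)) μ := by
  simp only [mon, map_finsuppProd, map_pow]

theorem mon_eq_zero {u : I → R} {μ : I →₀ ℕ} {a : I} (hu : u a = 0) (hμ : μ a ≠ 0) :
    mon u μ = 0 :=
  Finset.prod_eq_zero (Finsupp.mem_support_iff.2 hμ) (by simp only [hu, zero_pow hμ])

end mon

variable {R : Type} [CommSemiring R] [Algebra ℝ≥0∞ R] [InfSum R]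

theorem isum_coeff_mul {I : Type} (g : (I →₀ ℕ) → R) (f h : MvPowerSeries I ℝ≥0∞) :
    isum (fun m => algebraMap ℝ≥0∞ R (MvPowerSeries.coeff m (f * h)) * g m)
      = isum fun i => isum fun j => algebraMap ℝ≥0∞ R (MvPowerSeries.coeff i f)
          * (algebraMap ℝ≥0∞ R (MvPowerSeries.coeff j h) * g (i + j)) := by
  classical
  simp_rw [MvPowerSeries.coeff_mul, map_sum, map_mul, Finset.sum_mul]
  rw [isum_antidiagonal (fun m i j => algebraMap ℝ≥0∞ R (MvPowerSeries.coeff i f)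
          * algebraMap ℝ≥0∞ R (MvPowerSeries.coeff j h) * g m)]
  simp_rw [mul_assoc]

/-- Evaluation of power series with coefficients in `[0, ∞]`. -/
def ev {I : Type} (ρ : I → R) : MvPowerSeries I ℝ≥0∞ →+* R where
  toFun f := isum fun d => algebraMap ℝ≥0∞ R (MvPowerSeries.coeff d f) * mon ρ d
  map_one' := by
    classical
    rw [isum_single 0 _ fun d hd => by simp [MvPowerSeries.coeff_one, hd]]
    simp [mon_zero]
  map_mul' f h := by
    rw [isum_coeff_mul, ← isum_mul_right]
    refine congrArg isum (funext fun i => ?_)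
    rw [← isum_mul_left]
    refine congrArg isum (funext fun j => ?_)
    rw [mon_add]
    ring
  map_zero' := by simp [isum_zero]
  map_add' f h := by
    rw [← isum_add]
    simp only [map_add, add_mul]

theorem ev_apply {I : Type} (ρ : I → R) (f : MvPowerSeries I ℝ≥0∞) :
    ev ρ f = isum fun d => algebraMap ℝ≥0∞ R (MvPowerSeries.coeff d f) * mon ρ d := rfl

theorem ev_X {I : Type} (ρ : I → R) (a : I) : ev ρ (MvPowerSeries.X a) = ρ a := by
  classical
  rw [ev_apply, isum_single (Finsupp.single a 1) _ fun d hd => by simp [MvPowerSeries.coeff_X, hd]]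
  simp [MvPowerSeries.coeff_X, mon_single]

/-- Application and the conditional are interpreted by coefficientwise infinite sums; evaluation
commutes with them because both are sums of non-negative terms that may be exchanged. -/
theorem ev_tsum {I ι : Type} (ρ : I → R) (F : ι → MvPowerSeries I ℝ≥0∞) :
    ev ρ (mkSeries fun d => ∑' i, MvPowerSeries.coeff d (F i)) = isum fun i => ev ρ (F i) := by
  simp_rw [ev_apply]
  rw [isum_comm]
  refine congrArg isum (funext fun d => ?_)
  rw [isum_mul_right]
  congr 1
  exact algebraMap_isum _

theorem isum_sumElim {I J : Type} (F : (I ⊕ J →₀ ℕ) → R) :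
    isum F = isum fun μ : I →₀ ℕ => isum fun ν : J →₀ ℕ => F (Finsupp.sumElim μ ν) := by
  rw [← isum_equiv Finsupp.sumFinsuppEquivProdFinsupp.symm, ← isum_prod]
  rfl

/-- The function described by a matrix whose rows are indexed by finite multisets. -/
def rApp {I J : Type} (s : (I →₀ ℕ) × J → R) (u : I → R) : J → R :=
  fun b => isum fun μ : I →₀ ℕ => s (μ, b) * mon u μ

end PCoh

-- Interpretations of terms as functions of an environment.

namespace PPCF

open PCoh InfSum

variable {R : Type} [CommSemiring R] [Algebra ℝ≥0∞ R] [InfSum R]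

/-- The value of the interpretation of a term in an environment. -/
def tev {Γ : List Ty} {σ : Ty} (ρ : CtxWeb Γ → R) (M : Tm Γ σ) : σ.Web → R :=
  fun a => ev ρ (M.sem a)

/-- Extension of an environment. -/
def econs {Γ : List Ty} {σ : Ty} (v : σ.Web → R) (ρ : CtxWeb Γ → R) : CtxWeb (σ :: Γ) → R :=
  Sum.elim v ρ

/-- The basis vector `e_n`. -/
def basis (R : Type) [CommSemiring R] (n : ℕ) : ℕ → R := fun k => if k = n then 1 else 0

theorem tev_var {Γ : List Ty} {σ : Ty} (ρ : CtxWeb Γ → R) (x : Var Γ σ) (a : σ.Web) :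
    tev ρ (.var x) a = ρ (x.inj a) := by
  simp only [tev, Tm.sem, ev_X]

theorem tev_num {Γ : List Ty} (ρ : CtxWeb Γ → R) (n : ℕ) :
    tev ρ (.num n) = basis R n := by
  funext (k : ℕ)
  simp only [tev, Tm.sem, basis]
  split_ifs <;> simp

/-- A monomial in `z` containing a point other than `n` vanishes at `e_n`, and every power of `n`
takes the value `1`; only the multisets `k • [n]` survive. -/
theorem ev_atNum {Γ : List Ty} (ρ : CtxWeb Γ → R) (n : ℕ)
    (f : MvPowerSeries (CtxWeb (.nat :: Γ)) ℝ≥0∞) :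
    ev ρ (atNum n f) = ev (econs (σ := .nat) (basis R n) ρ) f := by
  classical
  have h : ∀ k : ℕ, mon (basis R n) (Finsupp.single n k) = 1 := fun k => by
    simp [mon_single, basis]
  have h2 := isum_sumElim (I := ℕ) (J := CtxWeb Γ)
    fun d => algebraMap ℝ≥0∞ R (MvPowerSeries.coeff (R := ℝ≥0∞) d f) *
      mon (Sum.elim (basis R n) ρ) d
  refine Eq.trans ?_ h2.symm
  have h3 := isum_inj (g := fun k : ℕ => Finsupp.single n k) (Finsupp.single_injective n)
    (fun μ : ℕ →₀ ℕ => isum fun ν : CtxWeb Γ →₀ ℕ =>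
      algebraMap ℝ≥0∞ R (MvPowerSeries.coeff (R := ℝ≥0∞) (Finsupp.sumElim μ ν) f) *
      mon (Sum.elim (basis R n) ρ) (Finsupp.sumElim μ ν)) ?_
  · rw [← h3, ev_apply, isum_comm]
    refine congrArg isum (funext fun d => ?_)
    simp_rw [mon_sumElim, h, one_mul, isum_mul_right]
    congr 1
    exact algebraMap_isum _
  · intro μ hμ
    obtain ⟨j, hj, hj'⟩ : ∃ j, j ≠ n ∧ μ j ≠ 0 := by
      by_contra! hc
      refine hμ ⟨μ n, ?_⟩
      ext j
      by_cases hj : j = n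
      · simp [hj]
      · simp [hc j hj, Ne.symm hj]
    have : mon (basis R n) μ = 0 := mon_eq_zero (a := j) (by simp [basis, hj]) hj'
    simp_rw [mon_sumElim, this, zero_mul, mul_zero, isum_zero]

theorem tev_ifz {Γ : List Ty} {σ : Ty} (ρ : CtxWeb Γ → R) (M : Tm Γ .nat) (P : Tm Γ σ)
    (Q : Tm (.nat :: Γ) σ) (a : σ.Web) :
    tev ρ (.ifz M P Q) a = tev ρ M (0 : ℕ) * tev ρ P a +
      isum fun n : ℕ => tev ρ M (n + 1 : ℕ) * tev (econs (σ := .nat) (basis R n) ρ) Q a := by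
  have h : (Tm.ifz M P Q).sem a = M.sem (0 : ℕ) * P.sem a +
      mkSeries fun d => ∑' n : ℕ,
        MvPowerSeries.coeff d (M.sem (n + 1 : ℕ) * atNum n (Q.sem a)) := rfl
  simp only [tev, h, map_add, map_mul, ev_tsum, ev_atNum]

/-- The β-rule: a multiset over the extended context splits into its part in the bound variable and
its part in `Γ`, and its monomial factors accordingly. -/
theorem rApp_tev_lam {Γ : List Ty} {σ τ : Ty} (ρ : CtxWeb Γ → R) (M : Tm (σ :: Γ) τ)
    (v : σ.Web → R) : rApp (tev ρ (.lam σ M)) v = tev (econs v ρ) M := by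
  funext b
  refine Eq.trans ?_ (isum_sumElim (I := σ.Web) (J := CtxWeb Γ)
    fun d => algebraMap ℝ≥0∞ R (MvPowerSeries.coeff (R := ℝ≥0∞) d (M.sem b)) *
      mon (Sum.elim v ρ) d).symm
  refine congrArg isum (funext fun μ => ?_)
  rw [tev, ev_apply, ← isum_mul_right]
  refine congrArg isum (funext fun d => ?_)
  rw [mon_sumElim, mul_assoc, mul_comm (mon v μ)]
  rfl

theorem tev_app {Γ : List Ty} {σ τ : Ty} (ρ : CtxWeb Γ → R) (M : Tm Γ (.arr σ τ)) (N : Tm Γ σ) :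
    tev ρ (.app M N) = rApp (tev ρ M) (tev ρ N) := by
  funext b
  refine (ev_tsum ρ fun m => M.sem (m, b) * mon N.sem m).trans
    (congrArg isum (funext fun m => ?_))
  rw [map_mul, map_mon]
  rfl

/-- The identity fixes `0`: nonempty multisets give a factor `0`, and the empty one gives a
coefficient of the variable at exponent `0`. All iterates are then `0`, and so is their supremum. -/
theorem sem_omega {Γ : List Ty} (σ : Ty) : (omega σ : Tm Γ σ).sem = fun _ => 0 := by
  have key : kapp (Tm.lam σ (.var .zero) : Tm Γ _).sem (fun _ => 0) = fun _ => 0 := by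
    classical
    funext b
    ext d
    refine ENNReal.tsum_eq_zero.2 fun m => ?_
    by_cases hm : m = 0
    · subst hm
      rw [Finsupp.prod_zero_index, mul_one]
      change MvPowerSeries.coeff (Finsupp.sumElim 0 d) (MvPowerSeries.X (Sum.inl b)) = _
      rw [MvPowerSeries.coeff_X, if_neg]
      intro h
      have := DFunLike.congr_fun h (Sum.inl b)
      simp at this
    · obtain ⟨a, ha⟩ := Finsupp.ne_iff.1 hm
      have : m.prod (fun _ k => (0 : MvPowerSeries (CtxWeb Γ) ℝ≥0∞) ^ k) = 0 :=
        mon_eq_zero (u := fun _ => 0) rfl ha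
      rw [this, mul_zero, map_zero]
  funext a
  ext d
  have h : ∀ n : ℕ, (kapp (Tm.lam σ (.var .zero) : Tm Γ _).sem)^[n] (fun _ => 0) = fun _ => 0 := by
    intro n
    induction n with
    | zero => rfl
    | succ n ih => rw [Function.iterate_succ_apply', ih, key]
  change ⨆ n : ℕ, MvPowerSeries.coeff d
    ((kapp (Tm.lam σ (.var .zero) : Tm Γ _).sem)^[n] (fun _ => 0) a) = _
  simp [h]

theorem tev_omega {Γ : List Ty} {σ : Ty} (ρ : CtxWeb Γ → R) (a : σ.Web) :
    tev ρ (omega σ) a = 0 := by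
  rw [tev, sem_omega, map_zero]

/-- The entries of the interpretation of an abstraction are the coefficients of the value of its
body at a generic argument. -/
theorem tev_lam_eq_coeff {Γ : List Ty} {σ τ : Ty} (ρ : CtxWeb Γ → R) (M : Tm (σ :: Γ) τ)
    (m : σ.Web →₀ ℕ) (b : τ.Web) :
    tev ρ (.lam σ M) (m, b) = MvPowerSeries.coeff m
      (tev (R := MvPowerSeries σ.Web R) (econs MvPowerSeries.X fun i => MvPowerSeries.C (ρ i)) M b)
    := by
  classical
  have h := isum_sumElim (R := MvPowerSeries σ.Web R) (I := σ.Web) (J := CtxWeb Γ)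
    fun d => algebraMap ℝ≥0∞ _ (MvPowerSeries.coeff (R := ℝ≥0∞) d (M.sem b)) *
      mon (Sum.elim MvPowerSeries.X fun i => MvPowerSeries.C (ρ i)) d
  -- At the generic argument the monomial of `μ` is the formal monomial itself, so taking the
  -- coefficient at `m` selects the terms with `μ = m`.
  have hX : ∀ μ : σ.Web →₀ ℕ,
      mon MvPowerSeries.X μ = (MvPowerSeries.monomial μ 1 : MvPowerSeries σ.Web R) := fun μ =>
    (MvPowerSeries.monomial_one_eq μ).symm
  refine Eq.trans ?_ (congrArg (MvPowerSeries.coeff m) h.symm)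
  have hc : ∀ (μ : σ.Web →₀ ℕ) (d : CtxWeb Γ →₀ ℕ) (r : ℝ≥0∞),
      MvPowerSeries.coeff m (algebraMap ℝ≥0∞ (MvPowerSeries σ.Web R) r *
        mon (Sum.elim MvPowerSeries.X fun i => MvPowerSeries.C (ρ i)) (Finsupp.sumElim μ d))
      = if μ = m then algebraMap ℝ≥0∞ R r * mon ρ d else 0 := by
    intro μ d r
    rw [mon_sumElim, ← map_mon (MvPowerSeries.C (σ := σ.Web) (R := R)),
      MvPowerSeries.algebraMap_apply, hX, mul_comm (MvPowerSeries.monomial μ 1), ← mul_assoc,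
      ← map_mul, MvPowerSeries.coeff_C_mul, MvPowerSeries.coeff_monomial]
    simp only [eq_comm (a := m), mul_ite, mul_one, mul_zero]
  simp only [coeff_isum, hc]
  rw [isum_single m]
  · simp only [if_true]
    rfl
  · intro μ hμ
    simp only [if_neg hμ, isum_zero]

/-! ### Values of the auxiliary terms -/

theorem tev_var_zero {Γ : List Ty} {σ : Ty} (v : σ.Web → R) (ρ : CtxWeb Γ → R) :
    tev (econs v ρ) (.var .zero) = v := by
  funext a
  rw [tev_var]
  rfl

theorem tev_var_succ {Γ : List Ty} {σ τ : Ty} (v : σ.Web → R) (ρ : CtxWeb Γ → R) (x : Var Γ τ) :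
    tev (econs v ρ) (.var (.succ x)) = tev ρ (.var x) := by
  funext a
  rw [tev_var, tev_var]
  rfl

theorem isum_mul_basis (f : ℕ → R) (k : ℕ) :
    isum (fun n => f n * basis R n k) = f k := by
  simp only [basis, mul_ite, mul_one, mul_zero, eq_comm (a := k)]
  exact isum_ite k f

theorem rApp_probe {Γ : List Ty} (ρ : CtxWeb Γ → R) (k : ℕ) (u : ℕ → R) :
    rApp (tev ρ (probe k)) u (0 : ℕ) = u k := by
  induction k generalizing Γ u with
  | zero =>
    rw [probe, rApp_tev_lam, tev_ifz, tev_var_zero, tev_num]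
    simp only [tev_omega, mul_zero, isum_zero, basis, if_true, mul_one, add_zero]
  | succ k ih =>
    rw [probe, rApp_tev_lam, tev_ifz, tev_var_zero]
    simp only [tev_omega, tev_app, tev_var_zero, ih, isum_mul_basis (fun n => u (n + 1)),
      mul_zero, zero_add]

theorem rApp_shift {Γ : List Ty} (ρ : CtxWeb Γ → R) (k : ℕ) (u : ℕ → R) :
    rApp (tev ρ (shift k)) u = fun i : ℕ => u (i + k) := by
  induction k generalizing Γ u with
  | zero => rw [shift, rApp_tev_lam, tev_var_zero]; rfl
  | succ k ih =>
    funext i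
    rw [shift, rApp_tev_lam, tev_ifz, tev_var_zero]
    simp only [tev_omega, tev_app, tev_var_zero, ih]
    rw [isum_mul_basis (fun n => u (n + 1)), mul_zero, zero_add, add_assoc]

/-- Iterated application. -/
def rAppN {σ τ : Ty} : (k : ℕ) → ((σ.pow k τ).Web → R) → (Fin k → σ.Web → R) → τ.Web → R
  | 0, s, _ => s
  | k + 1, s, v => rAppN k (rApp (I := σ.Web) (J := (σ.pow k τ).Web) s (v 0)) fun i => v i.succ

theorem tev_appN {Γ : List Ty} {σ τ : Ty} (ρ : CtxWeb Γ → R) (k : ℕ) (M : Tm Γ (σ.pow k τ))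
    (N : Fin k → Tm Γ σ) : tev ρ (.appN k M N) = rAppN k (tev ρ M) fun i => tev ρ (N i) := by
  induction k with
  | zero => rfl
  | succ k ih =>
    rw [Tm.appN, ih]
    congr 1
    exact tev_app ρ _ _

/-- Needed for `Prod`: its conditional multiplies a function still awaiting arguments by a scalar,
which passes outside since application is linear in the function. -/
theorem rAppN_mul_left {σ τ : Ty} (k : ℕ) (r : R) (s : (σ.pow k τ).Web → R)
    (v : Fin k → σ.Web → R) : rAppN k (fun a => r * s a) v = fun b => r * rAppN k s v b := by
  induction k with
  | zero => rfl
  | succ k ih =>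
    rw [rAppN, rAppN, ← ih]
    congr 1
    funext b
    simp only [rApp, mul_assoc]
    exact isum_mul_left _ _

theorem rAppN_pprod {Γ : List Ty} (ρ : CtxWeb Γ → R) (k : ℕ) (v : Fin k → ℕ → R) :
    rAppN (σ := .nat) (τ := .nat) k (tev ρ (pprod k)) v (0 : ℕ) = ∏ i, v i 0 := by
  induction k generalizing Γ with
  | zero =>
    rw [Fin.prod_univ_zero]
    exact (congrFun (tev_num ρ 0) (0 : ℕ)).trans (if_pos rfl)
  | succ k ih =>
    rw [Fin.prod_univ_succ, ← ih (econs (σ := .nat) (v 0) ρ)]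
    refine Eq.trans ?_ (congrFun (rAppN_mul_left (σ := .nat) (τ := .nat) k (v 0 0) _ _) (0 : ℕ))
    rw [rAppN, pprod]
    congr 1
    refine (rApp_tev_lam ρ _ _).trans (funext fun a => ?_)
    rw [tev_ifz, tev_var_zero]
    simp only [tev_omega, mul_zero, isum_zero, add_zero]

/-- Extension of an environment by several values of the same type. -/
def extEnv {σ : Ty} : (k : ℕ) → {Γ : List Ty} → (CtxWeb Γ → R) → (Fin k → σ.Web → R) →
    CtxWeb (extN σ k Γ) → R
  | 0, _, ρ, _ => ρ
  | k + 1, _, ρ, v => extEnv k (econs (v 0) ρ) fun i => v i.succ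

theorem rAppN_tev_lamN {Γ : List Ty} {σ τ : Ty} (ρ : CtxWeb Γ → R) (k : ℕ)
    (M : Tm (extN σ k Γ) τ) (v : Fin k → σ.Web → R) :
    rAppN k (tev ρ (Tm.lamN σ k M)) v = tev (extEnv k ρ v) M := by
  induction k generalizing Γ with
  | zero => rfl
  | succ k ih =>
    rw [rAppN, Tm.lamN]
    refine Eq.trans ?_ (ih (econs (v 0) ρ) M fun i => v i.succ)
    congr 1
    exact rApp_tev_lam ρ _ _

theorem tev_lift {Γ : List Ty} {σ τ : Ty} (ρ : CtxWeb Γ → R) (k : ℕ) (v : Fin k → σ.Web → R)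
    (x : Var Γ τ) : tev (extEnv k ρ v) (.var (Var.lift k x)) = tev ρ (.var x) := by
  induction k generalizing Γ with
  | zero => rfl
  | succ k ih =>
    refine (ih (econs (v 0) ρ) (fun i => v i.succ) (.succ x)).trans ?_
    exact tev_var_succ _ _ _

theorem tev_nth {Γ : List Ty} {σ : Ty} (ρ : CtxWeb Γ → R) (k : ℕ) (v : Fin k → σ.Web → R)
    (i : Fin k) : tev (extEnv k ρ v) (.var (Var.nth k i)) = v i := by
  induction k generalizing Γ with
  | zero => exact i.elim0
  | succ k ih =>
    refine Fin.cases ?_ (fun j => ?_) i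
    · exact (tev_lift (econs (v 0) ρ) k _ .zero).trans (tev_var_zero _ _)
    · exact ih (econs (v 0) ρ) (fun i => v i.succ) j

theorem rAppN_pchoose {Γ : List Ty} {σ : Ty} (ρ : CtxWeb Γ → R) (k : ℕ) (u : ℕ → R)
    (v : Fin k → σ.Web → R) (a : σ.Web) :
    rAppN k (rApp (tev ρ (pchoose σ k)) u) v a = ∑ i : Fin k, u i * v i a := by
  induction k generalizing Γ u with
  | zero =>
    rw [Fin.sum_univ_zero]
    exact (congrFun (rApp_tev_lam (σ := .nat) ρ (omega σ) u) a).trans (tev_omega _ a)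
  | succ k ih =>
    rw [pchoose, rApp_tev_lam, rAppN_tev_lamN, tev_ifz, tev_lift, tev_nth, tev_var_zero]
    simp only [tev_appN, tev_app, tev_var_zero, tev_var_succ, tev_nth, ih, Finset.mul_sum,
      isum_finset_sum]
    rw [Fin.sum_univ_succ]
    congr 1
    refine Finset.sum_congr rfl fun i _ => ?_
    simp only [← mul_assoc, isum_mul_right]
    rw [isum_mul_basis (fun n => u (n + 1))]
    rfl

/-- The exception made for the first argument is harmless, because its offset is an empty sum and a
shift by `0` changes nothing. -/
theorem tev_shiftFrom {Γ : List Ty} {k : ℕ} (ρ : CtxWeb Γ → R) (i : Fin k) (n : ℕ)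
    (M : Tm Γ .nat) (h : (i : ℕ) = 0 → n = 0) :
    tev ρ (shiftFrom i n M) = fun j : ℕ => tev ρ M (j + n : ℕ) := by
  unfold shiftFrom
  split_ifs with hi
  · rw [h hi]; rfl
  · rw [tev_app, rApp_shift]

/-! ### Values of the testing terms -/

/-- The sequence `u` without its first `n` elements. -/
def drop (n : ℕ) (u : ℕ → ℝ≥0∞) : ℕ → ℝ≥0∞ := fun i => u (i + n)

theorem drop_drop (n m : ℕ) (u : ℕ → ℝ≥0∞) : drop n (drop m u) = drop (m + n) u := by
  funext i
  simp only [drop]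
  congr 1
  omega

/-- `∑ i, t i • P bᵢ vᵢ`, where `vᵢ` is the part of `v` following the blocks of the `bⱼ`,
`j < i`. -/
def mixL {B I : Type} (P : B → (ℕ → ℝ≥0∞) → I → ℝ≥0∞) (len : B → ℕ) :
    List B → (ℕ → ℝ≥0∞) → (ℕ → ℝ≥0∞) → I → ℝ≥0∞
  | [], _, _ => fun _ => 0
  | b :: bs, t, v => fun a => t 0 * P b v a + mixL P len bs (drop 1 t) (drop (len b) v) a

/-- The linear form with given coefficients, as a power series. -/
def linForm {I : Type} (f : I → ℝ≥0∞) : MvPowerSeries I ℝ≥0∞ :=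
  mkSeries fun m => ∑' b, f b * MvPowerSeries.coeff m (MvPowerSeries.X b : MvPowerSeries I ℝ≥0∞)

/-- The product of the linear forms `N bᵢ vᵢ`. -/
def prodL {B I : Type} (N : B → (ℕ → ℝ≥0∞) → I → ℝ≥0∞) (len : B → ℕ) :
    List B → (ℕ → ℝ≥0∞) → MvPowerSeries I ℝ≥0∞
  | [], _ => 1
  | b :: bs, v => linForm (N b v) * prodL N len bs (drop (len b) v)

/-- The total length of the blocks of the elements of a list. -/
def lenL {B : Type} (len : B → ℕ) (l : List B) : ℕ := (l.map len).sum

mutual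

/-- The value of `P_a` at `u`. -/
def psem : (σ : Ty) → Enum σ → (ℕ → ℝ≥0∞) → σ.Web → ℝ≥0∞
  | .nat, (n : ℕ), _ => basis ℝ≥0∞ n
  | .arr φ ψ, (e : List (Enum φ) × Enum ψ), u => fun p =>
      MvPowerSeries.coeff p.1 (prodL (nsem φ) (fun b => nlen φ b.point) e.1 u) *
        psem ψ e.2 (drop (lenL (fun b => nlen φ b.point) e.1) u) p.2

/-- The matrix of the linear function `N_a u`. -/
def nsem : (σ : Ty) → Enum σ → (ℕ → ℝ≥0∞) → σ.Web → ℝ≥0∞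
  | .nat, (n : ℕ), _ => basis ℝ≥0∞ n
  | .arr φ ψ, (e : List (Enum φ) × Enum ψ), u => fun p =>
      mon (mixL (psem φ) (fun b => plen φ b.point) e.1 u (drop e.1.length u)) p.1 *
        nsem ψ e.2 (drop (e.1.length + lenL (fun b => plen φ b.point) e.1) u) p.2

end

theorem mixL_eq_sum {B I : Type} (P : B → (ℕ → ℝ≥0∞) → I → ℝ≥0∞) (len : B → ℕ) (l : List B)
    (t v : ℕ → ℝ≥0∞) (a : I) :
    mixL P len l t v a =
      ∑ i : Fin l.length, t i * P (l.get i) (drop (lenL len (l.take i)) v) a := by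
  induction l generalizing t v with
  | nil => simp [mixL]
  | cons b bs ih =>
    change t 0 * P b v a + mixL P len bs (drop 1 t) (drop (len b) v) a = _
    rw [ih]
    simp only [drop_drop]
    exact (Fin.sum_univ_succ (n := bs.length) (fun i : Fin (b :: bs).length =>
      t i * P ((b :: bs).get i) (drop (lenL len ((b :: bs).take i)) v) a)).symm

theorem prodL_eq_prod {B I : Type} (N : B → (ℕ → ℝ≥0∞) → I → ℝ≥0∞) (len : B → ℕ) (l : List B)
    (v : ℕ → ℝ≥0∞) :
    prodL N len l v =
      ∏ i : Fin l.length, linForm (N (l.get i) (drop (lenL len (l.take i)) v)) := by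
  induction l generalizing v with
  | nil => simp [prodL]
  | cons b bs ih =>
    rw [prodL, ih]
    simp only [drop_drop]
    exact (Fin.prod_univ_succ (n := bs.length) (fun i : Fin (b :: bs).length =>
      linForm (N ((b :: bs).get i) (drop (lenL len ((b :: bs).take i)) v)))).symm

theorem ev_linForm {I : Type}
    (ρ : I → R) (f : I → ℝ≥0∞) :
    ev ρ (linForm f) = isum fun b => algebraMap ℝ≥0∞ R (f b) * ρ b := by
  have h : linForm f = mkSeries fun m => ∑' b,
      MvPowerSeries.coeff m (MvPowerSeries.C (f b) * MvPowerSeries.X b) := by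
    simp only [MvPowerSeries.coeff_C_mul]; rfl
  rw [h, ev_tsum]
  refine congrArg isum (funext fun b => ?_)
  classical
  rw [map_mul, ev_X, ev_apply, isum_single 0 _ fun d hd => by simp [MvPowerSeries.coeff_C, hd]]
  simp [mon_zero]

theorem ev_X_env {I : Type}
    (f : MvPowerSeries I ℝ≥0∞) (m : I →₀ ℕ) :
    MvPowerSeries.coeff m (ev (R := MvPowerSeries I R) MvPowerSeries.X f) =
      algebraMap ℝ≥0∞ R (MvPowerSeries.coeff m f) := by
  classical
  have hX : ∀ μ : I →₀ ℕ,
      mon MvPowerSeries.X μ = (MvPowerSeries.monomial μ 1 : MvPowerSeries I R) := fun μ =>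
    (MvPowerSeries.monomial_one_eq μ).symm
  rw [ev_apply, coeff_isum, isum_single m]
  · rw [hX, MvPowerSeries.algebraMap_apply, MvPowerSeries.coeff_C_mul,
      MvPowerSeries.coeff_monomial_same, mul_one]
  · intro d hd
    rw [hX, MvPowerSeries.algebraMap_apply, MvPowerSeries.coeff_C_mul,
      MvPowerSeries.coeff_monomial_ne hd.symm, mul_zero]

theorem ptest_arr {φ ψ : Ty} (e : List (Enum φ) × Enum ψ) {Γ : List Ty} :
    (ptest (.arr φ ψ) e : Tm Γ _) = .lam .nat (.lam φ (.ifz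
      (Tm.appN e.1.length (pprod e.1.length) fun i =>
        .app
          (.app (ntest φ (e.1.get i))
            (shiftFrom i (lenL (fun b => nlen φ b.point) (e.1.take i)) (.var (.succ .zero))))
          (.var .zero))
      (.app (ptest ψ e.2)
        (.app (shift (lenL (fun b => nlen φ b.point) e.1)) (.var (.succ .zero))))
      (omega ψ))) := rfl

theorem ntest_arr {φ ψ : Ty} (e : List (Enum φ) × Enum ψ) {Γ : List Ty} :
    (ntest (.arr φ ψ) e : Tm Γ _) = .lam .nat (.lam (.arr φ ψ)
      (.app
        (.app (ntest ψ e.2)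
          (.app (shift (e.1.length + lenL (fun b => plen φ b.point) e.1)) (.var (.succ .zero))))
        (.app (.var .zero)
          (Tm.appN e.1.length (.app (pchoose φ e.1.length) (.var (.succ .zero))) fun i =>
            .app (ptest φ (e.1.get i))
              (.app (shift (e.1.length + lenL (fun b => plen φ b.point) (e.1.take i)))
                (.var (.succ .zero))))))) := rfl

/-- Kept apart from the induction, with the induction hypotheses as assumptions, so that it can be
used over a power series ring in which `x` is a generic point. -/
theorem tev_ptest_body {φ ψ : Ty}
    (e : List (Enum φ) × Enum ψ) {Γ : List Ty} (ρ : CtxWeb (φ :: .nat :: Γ) → R)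
    (u : ℕ → ℝ≥0∞) (hξ : tev ρ (.var (.succ .zero)) = fun i : ℕ => algebraMap ℝ≥0∞ R (u i))
    (hN : ∀ (e : Enum φ) (u : ℕ → ℝ≥0∞) (w : φ.Web → R),
      rApp (rApp (tev ρ (ntest φ e)) (fun i : ℕ => algebraMap ℝ≥0∞ R (u i))) w (0 : ℕ) =
        isum fun b => algebraMap ℝ≥0∞ R (nsem φ e u b) * w b)
    (hP : ∀ (e : Enum ψ) (u : ℕ → ℝ≥0∞),
      rApp (tev ρ (ptest ψ e)) (fun i : ℕ => algebraMap ℝ≥0∞ R (u i)) =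
        fun a => algebraMap ℝ≥0∞ R (psem ψ e u a)) (c : ψ.Web) :
    tev ρ (.ifz
      (Tm.appN e.1.length (pprod e.1.length) fun i =>
        .app
          (.app (ntest φ (e.1.get i))
            (shiftFrom i (lenL (fun b => nlen φ b.point) (e.1.take i)) (.var (.succ .zero))))
          (.var .zero))
      (.app (ptest ψ e.2)
        (.app (shift (lenL (fun b => nlen φ b.point) e.1)) (.var (.succ .zero))))
      (omega ψ)) c =
    ev (fun a => tev ρ (.var .zero) a) (prodL (nsem φ) (fun b => nlen φ b.point) e.1 u) *
      algebraMap ℝ≥0∞ R (psem ψ e.2 (drop (lenL (fun b => nlen φ b.point) e.1) u) c) := by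
  rw [tev_ifz]
  simp only [tev_omega, mul_zero, isum_zero, add_zero]
  rw [tev_appN, prodL_eq_prod, map_prod, tev_app, tev_app, hξ, rApp_shift]
  congr 1
  · refine (rAppN_pprod ρ e.1.length _).trans (Finset.prod_congr rfl fun i _ => ?_)
    rw [tev_app, tev_app, tev_shiftFrom _ _ _ _ (fun h => by simp [h, lenL]), hξ, ev_linForm]
    have h := hN (e.1.get i) (drop (lenL (fun b => nlen φ b.point) (e.1.take i)) u)
      (tev ρ (.var .zero))
    refine Eq.trans ?_ h
    rfl
  · exact congrFun (hP e.2 (drop (lenL (fun b => nlen φ b.point) e.1) u)) c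

/-- The ring `R` has to vary inside the induction: the entries of `P_a` at an arrow type are read
off at a generic argument, which calls for the value of `N_b` over `MvPowerSeries φ.Web R`. The
parameters `u` remain scalars throughout. -/
theorem tev_ptest_ntest (σ : Ty) :
    (∀ (R : Type) [CommSemiring R] [Algebra ℝ≥0∞ R] [InfSum R] (e : Enum σ) (Γ : List Ty)
      (ρ : CtxWeb Γ → R) (u : ℕ → ℝ≥0∞),
      rApp (tev ρ (ptest σ e)) (fun i : ℕ => algebraMap ℝ≥0∞ R (u i)) =
        fun a => algebraMap ℝ≥0∞ R (psem σ e u a)) ∧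
    ∀ (R : Type) [CommSemiring R] [Algebra ℝ≥0∞ R] [InfSum R] (e : Enum σ) (Γ : List Ty)
      (ρ : CtxWeb Γ → R) (u : ℕ → ℝ≥0∞) (w : σ.Web → R),
      rApp (rApp (tev ρ (ntest σ e)) (fun i : ℕ => algebraMap ℝ≥0∞ R (u i))) w (0 : ℕ) =
        isum fun b => algebraMap ℝ≥0∞ R (nsem σ e u b) * w b := by
  induction σ with
  | nat =>
    constructor
    · intro R _ _ _ (e : ℕ) Γ ρ u
      refine (rApp_tev_lam ρ (.num e) _).trans ?_
      rw [tev_num]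
      funext (a : ℕ)
      change (if a = e then (1 : R) else 0) = algebraMap ℝ≥0∞ R (if a = e then 1 else 0)
      split_ifs <;> simp
    · intro R _ _ _ (e : ℕ) Γ ρ u (w : ℕ → R)
      have h := rApp_tev_lam (σ := .nat) ρ (probe e) (fun i : ℕ => algebraMap ℝ≥0∞ R (u i))
      change rApp (rApp (tev ρ (.lam .nat (probe e))) _) w (0 : ℕ) =
        isum fun b : ℕ => algebraMap ℝ≥0∞ R (if b = e then 1 else 0) * w b
      rw [h, rApp_probe, isum_single e]
      · simp
      · intro j hj
        simp [hj]
  | arr φ ψ ihφ ihψ =>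
    constructor
    · intro R _ _ _ (e : List (Enum φ) × Enum ψ) Γ ρ u
      rw [ptest_arr, rApp_tev_lam]
      funext ⟨m, c⟩
      refine (tev_lam_eq_coeff _ _ m c).trans ?_
      have hξ : tev (R := MvPowerSeries φ.Web R) (econs (σ := φ) MvPowerSeries.X
          fun i => MvPowerSeries.C (econs (σ := .nat) (fun i : ℕ => algebraMap ℝ≥0∞ R (u i)) ρ i))
          (.var (.succ .zero)) =
          fun i : ℕ => algebraMap ℝ≥0∞ (MvPowerSeries φ.Web R) (u i) := by
        funext i
        rw [tev_var, MvPowerSeries.algebraMap_apply]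
        rfl
      have hb := tev_ptest_body e _ u hξ (fun e => ihφ.2 _ e _ _) (fun e => ihψ.1 _ e _ _) c
      refine (congrArg (MvPowerSeries.coeff m) hb).trans ?_
      rw [tev_var_zero, MvPowerSeries.algebraMap_apply, mul_comm, MvPowerSeries.coeff_C_mul,
        ev_X_env, ← map_mul, mul_comm]
      rfl
    · intro R _ _ _ (e : List (Enum φ) × Enum ψ) Γ ρ u w
      rw [ntest_arr, rApp_tev_lam, rApp_tev_lam, tev_app, tev_app, tev_app, tev_app, tev_var_zero,
        tev_var_succ, tev_var_zero, rApp_shift]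
      have h1 := ihψ.2 R e.2 _ (econs w (econs (σ := .nat)
        (fun i : ℕ => algebraMap ℝ≥0∞ R (u i)) ρ))
        (drop (e.1.length + lenL (fun b => plen φ b.point) e.1) u)
      refine (h1 _).trans ?_
      have h2 : tev (econs w (econs (σ := .nat) (fun i : ℕ => algebraMap ℝ≥0∞ R (u i)) ρ))
          (Tm.appN e.1.length (.app (pchoose φ e.1.length) (.var (.succ .zero))) fun i =>
              .app (ptest φ (e.1.get i))
                (.app (shift (e.1.length + lenL (fun b => plen φ b.point) (e.1.take i)))
                  (.var (.succ .zero)))) = fun a => algebraMap ℝ≥0∞ R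
          (mixL (psem φ) (fun b => plen φ b.point) e.1 u (drop e.1.length u) a) := by
        funext a
        rw [tev_appN, tev_app, rAppN_pchoose, mixL_eq_sum, map_sum, tev_var_succ, tev_var_zero]
        refine Finset.sum_congr rfl fun i _ => ?_
        rw [tev_app, tev_app, tev_var_succ, tev_var_zero, rApp_shift, map_mul]
        congr 1
        have h3 := ihφ.1 R (e.1.get i) _ (econs w (econs (σ := .nat)
          (fun i : ℕ => algebraMap ℝ≥0∞ R (u i)) ρ))
          (drop (e.1.length + lenL (fun b => plen φ b.point) (e.1.take i)) u)
        rw [drop_drop]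
        exact congrFun h3 a
      simp only [h2]
      simp only [rApp, ← isum_mul_left]
      -- The outer sum comes from `N_c` and the inner one from applying `w`, whereas points of the
      -- arrow web list the multiset first; hence the swap.
      rw [← isum_prod, ← isum_equiv (Equiv.prodComm _ _)]
      refine congrArg isum (funext fun p => ?_)
      simp only [nsem, map_mul, map_mon, Equiv.prodComm_apply, Prod.fst_swap, Prod.snd_swap]
      ring

/-- The value of the testing term `N_a`, as a linear function. -/
theorem funApp_ntest (σ : Ty) (e : Enum σ) (u : ℕ → ℝ≥0∞) (w : σ.Web → ℝ≥0∞) :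
    funApp (funApp (ntest σ e).csem u) w (0 : ℕ) = ∑' b, nsem σ e u b * w b := by
  have h : ((ntest σ e).csem : _ → ℝ≥0∞) =
      tev (Γ := []) (Empty.elim : Empty → ℝ≥0∞) (ntest σ e) := by
    funext a
    -- The web of the empty context is empty, so `0` is the only multiset over it.
    refine Eq.trans ?_ (isum_single (R := ℝ≥0∞) (0 : CtxWeb [] →₀ ℕ) _ fun d hd =>
      (hd (Finsupp.ext fun i : Empty => i.elim)).elim).symm
    exact (mul_one _).symm
  rw [h]
  exact (tev_ptest_ntest σ).2 ℝ≥0∞ e [] _ u w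

/-! ### Separation of points by families of vectors with rational parameters -/

/-- Sequences of rational numbers of sum at most `ε`. -/
def Adm (ε : ℝ≥0∞) (u : ℕ → ℝ≥0∞) : Prop :=
  (∀ i, ∃ q : ℚ≥0, u i = ((q : ℝ≥0) : ℝ≥0∞)) ∧ ∑' i, u i ≤ ε

/-- Equality of finite numbers. -/
def EqFin (x y : ℝ≥0∞) : Prop := x = y ∧ x ≠ ⊤

/-- The family `Q` of linear forms separates the vectors that differ at `a`, using small rational
parameters only. -/
def Sep {I : Type} (Q : (ℕ → ℝ≥0∞) → I → ℝ≥0∞) (a : I) : Prop :=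
  ∀ ε : ℝ≥0∞, 0 < ε → ∀ w w' : I → ℝ≥0∞,
    (∀ u, Adm ε u → EqFin (∑' i, Q u i * w i) (∑' i, Q u i * w' i)) → EqFin (w a) (w' a)

/-- `Q u` depends only on the first `n` elements of `u`. -/
def Loc {X : Type} (Q : (ℕ → ℝ≥0∞) → X) (n : ℕ) : Prop :=
  ∀ u v : ℕ → ℝ≥0∞, (∀ i < n, u i = v i) → Q u = Q v

/-- The first `n` elements of `u`, followed by `v`. -/
def glue (n : ℕ) (u v : ℕ → ℝ≥0∞) : ℕ → ℝ≥0∞ := fun i => if i < n then u i else v (i - n)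

theorem glue_lt {n i : ℕ} (u v : ℕ → ℝ≥0∞) (h : i < n) : glue n u v i = u i := if_pos h

theorem drop_glue (n : ℕ) (u v : ℕ → ℝ≥0∞) : drop n (glue n u v) = v := by
  funext i
  simp [drop, glue]

theorem tsum_glue_le (n : ℕ) (u v : ℕ → ℝ≥0∞) :
    ∑' i, glue n u v i ≤ ∑' i, u i + ∑' i, v i := by
  have h : ∑' i, v i = ∑' i, if i < n then 0 else v (i - n) := by
    rw [← (add_left_injective n).tsum_eq (f := fun i => if i < n then 0 else v (i - n))]
    · simp
    · intro i hi
      by_cases h : i < n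
      · simp [h] at hi
      · exact ⟨i - n, by simp only; omega⟩
  rw [h, ← ENNReal.tsum_add]
  refine ENNReal.tsum_le_tsum fun i => ?_
  unfold glue
  split_ifs <;> simp

theorem Adm.glue {ε : ℝ≥0∞} {u v : ℕ → ℝ≥0∞} (hu : Adm (ε / 2) u) (hv : Adm (ε / 2) v)
    (n : ℕ) : Adm ε (glue n u v) := by
  refine ⟨fun i => ?_, (tsum_glue_le n u v).trans ((add_le_add hu.2 hv.2).trans_eq
    (ENNReal.add_halves ε))⟩
  unfold PPCF.glue
  split_ifs
  · exact hu.1 i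
  · exact hv.1 _

theorem exists_rat_le {ε : ℝ≥0∞} (hε : 0 < ε) :
    ∃ q : ℚ≥0, 0 < q ∧ ((q : ℝ≥0) : ℝ≥0∞) ≤ ε := by
  obtain ⟨n, hn⟩ := ENNReal.exists_inv_nat_lt hε.ne'
  have hn0 : n ≠ 0 := by
    rintro rfl
    simp at hn
  refine ⟨(n : ℚ≥0)⁻¹, by positivity, ?_⟩
  rw [NNRat.cast_inv, NNRat.cast_natCast, ENNReal.coe_inv (by exact_mod_cast hn0)]
  simpa using hn.le

theorem tsum_mul_prod {M J : Type} (F : M → ℝ≥0∞) (G : J → ℝ≥0∞) (w : M × J → ℝ≥0∞) :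
    ∑' p : M × J, F p.1 * G p.2 * w p = ∑' c, G c * ∑' m, F m * w (m, c) := by
  rw [ENNReal.tsum_prod (f := fun m c => F m * G c * w (m, c)), ENNReal.tsum_comm]
  refine tsum_congr fun c => ?_
  rw [← ENNReal.tsum_mul_left]
  exact tsum_congr fun m => by ring

/-- With the first block fixed, `G` separates the partial sums over `m` as functions of `c`; then
`F` separates in `m`. The bound `ε` is halved so that the glued parameter is still admissible. -/
theorem Sep.prod {M J : Type} {F : (ℕ → ℝ≥0∞) → M → ℝ≥0∞} {G : (ℕ → ℝ≥0∞) → J → ℝ≥0∞} {n : ℕ}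
    {m : M} {c : J} (hF : Sep F m) (hF' : Loc F n) (hG : Sep G c) :
    Sep (fun u p => F u p.1 * G (drop n u) p.2) (m, c) := by
  intro ε hε w w' h
  have hε' : 0 < ε / 2 := ENNReal.half_pos hε.ne'
  refine hF (ε / 2) hε' (fun m => w (m, c)) (fun m => w' (m, c)) fun u hu => ?_
  refine hG (ε / 2) hε' (fun c => ∑' m, F u m * w (m, c)) (fun c => ∑' m, F u m * w' (m, c))
    fun v hv => ?_
  have := h _ (hu.glue hv n)
  beta_reduce at this
  rwa [drop_glue, hF' (glue n u v) u fun i hi => glue_lt u v hi, tsum_mul_prod, tsum_mul_prod]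
    at this

theorem Loc.prod {M J : Type} {F : (ℕ → ℝ≥0∞) → M → ℝ≥0∞} {G : (ℕ → ℝ≥0∞) → J → ℝ≥0∞} {n k : ℕ}
    (hF : Loc F n) (hG : Loc G k) :
    Loc (fun u (p : M × J) => F u p.1 * G (drop n u) p.2) (k + n) := by
  intro u v h
  have h1 := hF u v fun i hi => h i (by omega)
  have h2 := hG (drop n u) (drop n v) fun i hi => h (i + n) (by omega)
  simp only [h1, h2]

/-! ### Products of linear forms -/

theorem tsum_coeff_linForm {I : Type} (f : I → ℝ≥0∞) (g : (I →₀ ℕ) → ℝ≥0∞) :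
    ∑' m, MvPowerSeries.coeff m (linForm f) * g m = ∑' b, f b * g (Finsupp.single b 1) := by
  classical
  have h : ∀ m, MvPowerSeries.coeff m (linForm f) * g m =
      ∑' b, f b * (if m = Finsupp.single b 1 then g m else 0) := by
    intro m
    rw [linForm, coeff_mkSeries, ← ENNReal.tsum_mul_right]
    refine tsum_congr fun b => ?_
    rw [MvPowerSeries.coeff_X, mul_assoc, ite_mul, one_mul, zero_mul]
  rw [tsum_congr h, ENNReal.tsum_comm]
  refine tsum_congr fun b => ?_
  rw [ENNReal.tsum_mul_left]
  congr 1
  exact tsum_ite_eq (Finsupp.single b 1) g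

theorem tsum_coeff_linForm_mul {I : Type} (f : I → ℝ≥0∞) (h : MvPowerSeries I ℝ≥0∞)
    (g : (I →₀ ℕ) → ℝ≥0∞) :
    ∑' m, MvPowerSeries.coeff m (linForm f * h) * g m =
      ∑' b, f b * ∑' m, MvPowerSeries.coeff m h * g (Finsupp.single b 1 + m) := by
  refine (isum_coeff_mul (R := ℝ≥0∞) g (linForm f) h).trans ?_
  rw [← tsum_coeff_linForm f fun i => ∑' m, MvPowerSeries.coeff m h * g (i + m)]
  exact tsum_congr fun i => ENNReal.tsum_mul_left

/-- Multiplying by a linear form shifts the tested function by one point `[b]`. The tail of the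
product handles the shifted functions, and `N b` then isolates the shift by `pt b`. -/
theorem sep_prodL {B I : Type} (N : B → (ℕ → ℝ≥0∞) → I → ℝ≥0∞) (len : B → ℕ) (pt : B → I)
    (l : List B) (hN : ∀ b, Sep (N b) (pt b)) (hloc : ∀ b, Loc (N b) (len b)) :
    Sep (fun u m => MvPowerSeries.coeff m (prodL N len l u))
      (l.map fun b => Finsupp.single (pt b) 1).sum := by
  classical
  induction l with
  | nil =>
    intro ε hε w w' h
    have h0 := h (fun _ => 0) ⟨fun i => ⟨0, by simp⟩, by simp⟩
    have hw : ∀ w : (I →₀ ℕ) → ℝ≥0∞,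
        ∑' m, MvPowerSeries.coeff m (1 : MvPowerSeries I ℝ≥0∞) * w m = w 0 := by
      intro w
      rw [tsum_eq_single 0 fun m hm => by simp [MvPowerSeries.coeff_one, hm]]
      simp
    simp only [prodL] at h0
    rwa [hw, hw] at h0
  | cons b l ih =>
    intro ε hε w w' h
    have hε' : 0 < ε / 2 := ENNReal.half_pos hε.ne'
    rw [List.map_cons, List.sum_cons]
    refine ih (ε / 2) hε' (fun m => w (Finsupp.single (pt b) 1 + m))
      (fun m => w' (Finsupp.single (pt b) 1 + m)) fun v hv => ?_
    refine hN b (ε / 2) hε'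
      (fun b => ∑' m, MvPowerSeries.coeff m (prodL N len l v) * w (Finsupp.single b 1 + m))
      (fun b => ∑' m, MvPowerSeries.coeff m (prodL N len l v) * w' (Finsupp.single b 1 + m))
      fun u hu => ?_
    have := h _ (hu.glue hv (len b))
    simp only [prodL, drop_glue] at this
    rwa [hloc b (glue (len b) u v) u fun i hi => glue_lt u v hi, tsum_coeff_linForm_mul,
      tsum_coeff_linForm_mul] at this

theorem loc_prodL {B I : Type} (N : B → (ℕ → ℝ≥0∞) → I → ℝ≥0∞) (len : B → ℕ)
    (l : List B) (hloc : ∀ b, Loc (N b) (len b)) : Loc (prodL N len l) (lenL len l) := by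
  induction l with
  | nil => intro u v _; rfl
  | cons b l ih =>
    intro u v h
    have hl : lenL len (b :: l) = len b + lenL len l := by simp [lenL]
    rw [prodL, prodL, hloc b u v fun i hi => h i (by omega),
      ih (drop (len b) u) (drop (len b) v) fun i hi => h _ (by omega)]

/-! ### Directional derivatives of power series -/

/-- The value at `x` of the power series with coefficients `f`. -/
def val {I : Type} (f : (I →₀ ℕ) → ℝ≥0∞) (x : I → ℝ≥0∞) : ℝ≥0∞ := ∑' m, f m * mon x m

/-- The partial derivative of a power series. -/
def pderiv {I : Type} (a : I) (f : (I →₀ ℕ) → ℝ≥0∞) : (I →₀ ℕ) → ℝ≥0∞ :=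
  fun m => ((m a + 1 : ℕ) : ℝ≥0∞) * f (Finsupp.single a 1 + m)

/-- The monomial `(X p + x) ^ m`, as a polynomial in `X`. -/
def lineMon {I : Type} (p x : I → ℝ≥0∞) (m : I →₀ ℕ) : Polynomial ℝ≥0∞ :=
  mon (fun a => Polynomial.C (p a) * Polynomial.X + Polynomial.C (x a)) m

theorem eval_lineMon {I : Type} (p x : I → ℝ≥0∞) (m : I →₀ ℕ) (t : ℝ≥0∞) :
    (lineMon p x m).eval t = mon (fun a => t * p a + x a) m := by
  refine (map_mon (Polynomial.evalRingHom t) _ m).trans (congrArg (mon · m) (funext fun a => ?_))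
  rw [Polynomial.coe_evalRingHom, Polynomial.eval_add, Polynomial.eval_mul, Polynomial.eval_C,
    Polynomial.eval_X, Polynomial.eval_C, mul_comm]

theorem coeff_zero_lineMon {I : Type} (p x : I → ℝ≥0∞) (m : I →₀ ℕ) :
    (lineMon p x m).coeff 0 = mon x m := by
  rw [Polynomial.coeff_zero_eq_eval_zero, eval_lineMon]
  simp

/-- The Leibniz rule, by additivity in `m`. The truncated subtraction is harmless: where it
truncates, the factor `m a` is `0`. -/
theorem coeff_one_lineMon {I : Type} (p x : I → ℝ≥0∞) (m : I →₀ ℕ) :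
    (lineMon p x m).coeff 1 = ∑' a, (m a : ℝ≥0∞) * (p a * mon x (m - Finsupp.single a 1)) := by
  classical
  have hadd : ∀ f g : I →₀ ℕ,
      (lineMon p x f).coeff 1 = ∑' a, (f a : ℝ≥0∞) * (p a * mon x (f - Finsupp.single a 1)) →
      (lineMon p x g).coeff 1 = ∑' a, (g a : ℝ≥0∞) * (p a * mon x (g - Finsupp.single a 1)) →
      (lineMon p x (f + g)).coeff 1 =
        ∑' a, ((f + g) a : ℝ≥0∞) * (p a * mon x (f + g - Finsupp.single a 1)) := by
    intro f g hf hg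
    have hx : ∀ (f g : I →₀ ℕ) (a : I),
        (f a : ℝ≥0∞) * (p a * mon x (f + g - Finsupp.single a 1)) =
          (f a : ℝ≥0∞) * (p a * mon x (f - Finsupp.single a 1)) * mon x g := by
      intro f g a
      by_cases h0 : f a = 0
      · simp [h0]
      · have : f + g - Finsupp.single a 1 = f - Finsupp.single a 1 + g := by
          ext b
          simp only [Finsupp.tsub_apply, Finsupp.add_apply, Finsupp.single_apply]
          split_ifs with hb
          · subst hb
            omega
          · omega
        rw [this, mon_add]
        ring
    rw [lineMon, mon_add, ← lineMon, ← lineMon, Polynomial.mul_coeff_one, coeff_zero_lineMon,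
      coeff_zero_lineMon, hf, hg, ← ENNReal.tsum_mul_left, ← ENNReal.tsum_mul_right,
      ← ENNReal.tsum_add]
    refine tsum_congr fun a => ?_
    rw [Finsupp.add_apply, Nat.cast_add, add_mul, hx f g, add_comm f g, hx g f]
    ring
  induction m using Finsupp.induction_linear with
  | zero => simp [lineMon, mon_zero, Polynomial.coeff_one]
  | add f g hf hg => exact hadd f g hf hg
  | single b k =>
    induction k with
    | zero => simp [lineMon, mon_zero, Polynomial.coeff_one]
    | succ k ih =>
      rw [Finsupp.single_add]
      refine hadd _ _ ih ?_
      rw [tsum_eq_single b fun a ha => by simp [ha.symm]]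
      simp [lineMon, mon_single, mon_zero]

theorem tsum_coeff_one_lineMon {I : Type} (p x : I → ℝ≥0∞) (f : (I →₀ ℕ) → ℝ≥0∞) :
    ∑' m, f m * (lineMon p x m).coeff 1 = ∑' a, p a * val (pderiv a f) x := by
  simp_rw [coeff_one_lineMon, ← ENNReal.tsum_mul_left]
  rw [ENNReal.tsum_comm]
  refine tsum_congr fun a => ?_
  rw [val, ← ENNReal.tsum_mul_left, ← (add_right_injective (Finsupp.single a 1)).tsum_eq]
  · refine tsum_congr fun m => ?_
    simp only [pderiv, Finsupp.add_apply, Finsupp.single_eq_same, add_tsub_cancel_left]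
    rw [add_comm 1 (m a)]
    ring
  · intro m hm
    have h0 : m a ≠ 0 := by
      intro h0
      simp [h0] at hm
    refine ⟨m - Finsupp.single a 1, add_tsub_cancel_of_le ?_⟩
    rw [Finsupp.single_le_iff]
    omega

theorem eval_mono (Q : Polynomial ℝ≥0∞) : Monotone fun t => Q.eval t := by
  intro s t h
  simp only [Polynomial.eval_eq_sum_range]
  gcongr

/-- Taylor expansion to first order along `p`. The remainder collects the quotients of the monomials
after two divisions by the variable; their coefficients are non-negative, so it is monotone, though
possibly infinite. -/
theorem exists_val_line {I : Type} (p x : I → ℝ≥0∞) (f : (I →₀ ℕ) → ℝ≥0∞) :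
    ∃ K : ℝ≥0∞ → ℝ≥0∞, Monotone K ∧ ∀ t, val f (fun a => t * p a + x a) =
      val f x + t * ((∑' a, p a * val (pderiv a f) x) + t * K t) := by
  refine ⟨fun t => ∑' m, f m * (lineMon p x m).divX.divX.eval t, fun s t h =>
    ENNReal.tsum_le_tsum fun m => mul_le_mul_right (eval_mono _ h) _, fun t => ?_⟩
  rw [← tsum_coeff_one_lineMon, val, val, ← ENNReal.tsum_mul_left, ← ENNReal.tsum_add,
    ← ENNReal.tsum_mul_left, ← ENNReal.tsum_add]
  refine tsum_congr fun m => ?_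
  rw [← eval_lineMon, ← coeff_zero_lineMon p x m]
  conv_lhs => rw [← Polynomial.divX_mul_X_add (lineMon p x m),
    ← Polynomial.divX_mul_X_add (lineMon p x m).divX]
  simp only [Polynomial.eval_add, Polynomial.eval_mul, Polynomial.eval_C, Polynomial.eval_X,
    Polynomial.coeff_divX, zero_add]
  ring

/-- Taking `q = 0` identifies the constant terms, which are finite and cancel; dividing by `q` and
letting it tend to `0` leaves `B` and `B'`. Monotonicity bounds the remainders by their finite
values at a fixed `q₀`. -/
theorem eqFin_linear_coeff {ε A A' B B' : ℝ≥0∞} (hε : 0 < ε) {K K' : ℝ≥0∞ → ℝ≥0∞}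
    (hK : Monotone K) (hK' : Monotone K')
    (h : ∀ q : ℚ≥0, ((q : ℝ≥0) : ℝ≥0∞) ≤ ε →
      EqFin (A + (q : ℝ≥0) * (B + (q : ℝ≥0) * K (q : ℝ≥0)))
        (A' + (q : ℝ≥0) * (B' + (q : ℝ≥0) * K' (q : ℝ≥0)))) : EqFin B B' := by
  have hA : EqFin A A' := by simpa using h 0 (by simp)
  have cancel : ∀ q : ℚ≥0, 0 < q → ((q : ℝ≥0) : ℝ≥0∞) ≤ ε →
      EqFin (B + (q : ℝ≥0) * K (q : ℝ≥0)) (B' + (q : ℝ≥0) * K' (q : ℝ≥0)) := by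
    intro q hq hqε
    have hq0 : ((q : ℝ≥0) : ℝ≥0∞) ≠ 0 := by
      rw [ENNReal.coe_ne_zero]
      exact_mod_cast hq.ne'
    obtain ⟨h1, h2⟩ := h q hqε
    rw [← hA.1] at h1
    have h3 := (ENNReal.add_right_inj hA.2).1 h1
    refine ⟨(ENNReal.mul_right_inj hq0 ENNReal.coe_ne_top).1 h3, fun ht => h2 ?_⟩
    rw [ht, ENNReal.mul_top hq0, add_top]
  obtain ⟨q₀, hq₀, hq₀ε⟩ := exists_rat_le hε
  have hq0 : ((q₀ : ℝ≥0) : ℝ≥0∞) ≠ 0 := by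
    rw [ENNReal.coe_ne_zero]
    exact_mod_cast hq₀.ne'
  have le : ∀ {B B' : ℝ≥0∞} {K K' : ℝ≥0∞ → ℝ≥0∞}, Monotone K' →
      (∀ q : ℚ≥0, 0 < q → ((q : ℝ≥0) : ℝ≥0∞) ≤ ε →
        EqFin (B + (q : ℝ≥0) * K (q : ℝ≥0)) (B' + (q : ℝ≥0) * K' (q : ℝ≥0))) → B ≤ B' := by
    intro B B' K K' hK' h
    have hfin : K' (q₀ : ℝ≥0) ≠ ⊤ := by
      intro ht
      obtain ⟨h1, h2⟩ := h q₀ hq₀ hq₀ε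
      rw [ht, ENNReal.mul_top hq0, add_top] at h1
      exact h2 h1
    refine ENNReal.le_of_forall_pos_le_add fun δ hδ _ => ?_
    -- The first bound gives `K' q ≤ K' q₀`, the second then makes the remainder `q * K' q` at most
    -- `δ`.
    have hpos : 0 < min ((q₀ : ℝ≥0) : ℝ≥0∞) (δ / K' (q₀ : ℝ≥0)) :=
      lt_min (pos_iff_ne_zero.2 hq0)
        (ENNReal.div_pos (by exact_mod_cast hδ.ne') hfin)
    obtain ⟨q, hq, hqle⟩ := exists_rat_le hpos
    obtain ⟨hq1, hq2⟩ := le_min_iff.1 hqle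
    calc B ≤ B + (q : ℝ≥0) * K (q : ℝ≥0) := le_self_add
      _ = B' + (q : ℝ≥0) * K' (q : ℝ≥0) := (h q hq (hq1.trans hq₀ε)).1
      _ ≤ B' + (δ / K' (q₀ : ℝ≥0)) * K' (q₀ : ℝ≥0) := by
        gcongr
        exact hK' hq1
      _ ≤ B' + δ := by
        gcongr
        rw [mul_comm]
        exact ENNReal.mul_div_le
  refine ⟨le_antisymm (le hK' cancel) (le (K := K') hK fun q hq hqε => ?_), fun ht => ?_⟩
  · obtain ⟨h1, h2⟩ := cancel q hq hqε
    exact ⟨h1.symm, h1 ▸ h2⟩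
  · refine (cancel q₀ hq₀ hq₀ε).2 ?_
    rw [ht, top_add]

/-! ### Sums of vectors with rational coefficients -/

theorem loc_mixL {B I : Type} (P : B → (ℕ → ℝ≥0∞) → I → ℝ≥0∞) (len : B → ℕ) (l : List B)
    (hloc : ∀ b, Loc (P b) (len b)) {t t' v v' : ℕ → ℝ≥0∞} (ht : ∀ i < l.length, t i = t' i)
    (hv : ∀ i < lenL len l, v i = v' i) : mixL P len l t v = mixL P len l t' v' := by
  induction l generalizing t t' v v' with
  | nil => rfl
  | cons b l ih =>
    have hl : lenL len (b :: l) = len b + lenL len l := by simp [lenL]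
    rw [List.length_cons] at ht
    rw [mixL, mixL, hloc b v v' fun i hi => hv i (by omega), ht 0 (by omega),
      ih (t := drop 1 t) (t' := drop 1 t') (v := drop (len b) v) (v' := drop (len b) v')
        (fun i hi => ht _ (by omega)) (fun i hi => hv _ (by omega))]

theorem val_zero {I : Type} (f : (I →₀ ℕ) → ℝ≥0∞) : val f (fun _ => 0) = f 0 := by
  rw [val, tsum_eq_single 0, mon_zero, mul_one]
  intro m hm
  obtain ⟨a, ha⟩ := Finsupp.ne_iff.1 hm
  rw [mon_eq_zero (a := a) rfl ha, mul_zero]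

/-- Induction on the list with `f` and `f'` varying: the hypothesis passes to their partial
derivatives at `pt b`, evaluated at the combination of the remaining vectors. -/
theorem eqFin_of_val_mixL {B I : Type} (P : B → (ℕ → ℝ≥0∞) → I → ℝ≥0∞) (len : B → ℕ)
    (pt : B → I) (l : List B) (hP : ∀ b, Sep (P b) (pt b)) (hloc : ∀ b, Loc (P b) (len b))
    {ε : ℝ≥0∞} (hε : 0 < ε) (f f' : (I →₀ ℕ) → ℝ≥0∞)
    (h : ∀ t v, Adm ε t → Adm ε v →
      EqFin (val f (mixL P len l t v)) (val f' (mixL P len l t v))) :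
    EqFin (f (l.map fun b => Finsupp.single (pt b) 1).sum)
      (f' (l.map fun b => Finsupp.single (pt b) 1).sum) := by
  induction l generalizing ε f f' with
  | nil =>
    have h0 := h (fun _ => 0) (fun _ => 0) ⟨fun i => ⟨0, by simp⟩, by simp⟩
      ⟨fun i => ⟨0, by simp⟩, by simp⟩
    simp only [mixL, val_zero] at h0
    exact h0
  | cons b l ih =>
    have hε' : 0 < ε / 2 := ENNReal.half_pos hε.ne'
    have key := ih hε' (pderiv (pt b) f) (pderiv (pt b) f') fun t v ht hv => by
      refine hP b (ε / 2) hε' (fun a => val (pderiv a f) (mixL P len l t v))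
        (fun a => val (pderiv a f') (mixL P len l t v)) fun u hu => ?_
      obtain ⟨K, hK, hK1⟩ := exists_val_line (P b u) (mixL P len l t v) f
      obtain ⟨K', hK', hK1'⟩ := exists_val_line (P b u) (mixL P len l t v) f'
      refine eqFin_linear_coeff hε' hK hK' (A := val f (mixL P len l t v))
        (A' := val f' (mixL P len l t v)) fun q hq => ?_
      have hqa : Adm (ε / 2) (Pi.single 0 ((q : ℝ≥0) : ℝ≥0∞)) := by
        refine ⟨fun i => ?_, ?_⟩
        · by_cases hi : i = 0
          · exact ⟨q, by simp [hi]⟩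
          · exact ⟨0, by simp [hi]⟩
        · rwa [tsum_pi_single]
      -- The weight of the first vector is `q`, so the combination runs along the line in direction
      -- `P b u` through the combination for `l`.
      have := h _ _ (hqa.glue ht 1) (hu.glue hv (len b))
      rw [mixL, drop_glue, drop_glue, glue_lt _ _ one_pos,
        hloc b (glue (len b) u v) u fun i hi => glue_lt u v hi, Pi.single_eq_same, hK1, hK1']
        at this
      exact this
    rw [List.map_cons, List.sum_cons]
    obtain ⟨h1, h2⟩ := key
    simp only [pderiv] at h1 h2
    -- Differentiation multiplies the coefficient by a positive integer, which is cancelled.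
    have hn : ∀ n : ℕ, ((n + 1 : ℕ) : ℝ≥0∞) ≠ 0 := fun n => by simp
    refine ⟨(ENNReal.mul_right_inj (hn _) (ENNReal.natCast_ne_top _)).1 h1, fun ht => h2 ?_⟩
    rw [ht, ENNReal.mul_top (hn _)]

theorem loc_mon_mixL {B I : Type} (P : B → (ℕ → ℝ≥0∞) → I → ℝ≥0∞) (len : B → ℕ)
    (l : List B) (hloc : ∀ b, Loc (P b) (len b)) :
    Loc (fun u => mon (mixL P len l u (drop l.length u))) (l.length + lenL len l) := by
  intro u v h
  simp only
  rw [loc_mixL P len l hloc (t := u) (t' := v) (v := drop l.length u) (v' := drop l.length v)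
    (fun i hi => h i (by omega)) fun i hi => h _ (by omega)]

theorem sep_mon_mixL {B I : Type} (P : B → (ℕ → ℝ≥0∞) → I → ℝ≥0∞) (len : B → ℕ)
    (pt : B → I) (l : List B) (hP : ∀ b, Sep (P b) (pt b)) (hloc : ∀ b, Loc (P b) (len b)) :
    Sep (fun u => mon (mixL P len l u (drop l.length u)))
      (l.map fun b => Finsupp.single (pt b) 1).sum := by
  intro ε hε w w' h
  refine eqFin_of_val_mixL P len pt l hP hloc (ENNReal.half_pos hε.ne') w w' fun t v ht hv => ?_
  have := h _ (ht.glue hv l.length)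
  beta_reduce at this
  rw [drop_glue, loc_mixL P len l hloc (t := glue l.length t v) (t' := t) (v := v) (v' := v)
    (fun i hi => glue_lt t v hi) fun _ _ => rfl] at this
  simpa only [val, mul_comm] using this

/-! ### The testing terms separate points -/

/-- Converts sums over multisets with multiplicities, as in `plen` and `nlen`, into sums over the
chosen enumeration. -/
theorem sum_sum_single {B I : Type} (pt : B → I) (l : List B) (h : I → ℕ → ℕ)
    (h0 : ∀ i, h i 0 = 0) (hadd : ∀ i m n, h i (m + n) = h i m + h i n) :
    ((l.map fun b => Finsupp.single (pt b) 1).sum).sum h = (l.map fun b => h (pt b) 1).sum := by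
  classical
  induction l with
  | nil => simp
  | cons b l ih =>
    rw [List.map_cons, List.sum_cons, Finsupp.sum_add_index' h0 hadd, ih,
      Finsupp.sum_single_index (h0 _), List.map_cons, List.sum_cons]

theorem plen_point_arr {φ ψ : Ty} (e : List (Enum φ) × Enum ψ) :
    plen (.arr φ ψ) (Enum.point (.arr φ ψ) e) =
      plen ψ e.2.point + lenL (fun b => nlen φ b.point) e.1 := by
  have := sum_sum_single (Enum.point φ) e.1 (fun b k => k * nlen φ b) (by simp)
    (fun _ _ _ => add_mul _ _ _)
  simp only [one_mul] at this
  exact congrArg (plen ψ e.2.point + ·) this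

theorem nlen_point_arr {φ ψ : Ty} (e : List (Enum φ) × Enum ψ) :
    nlen (.arr φ ψ) (Enum.point (.arr φ ψ) e) =
      nlen ψ e.2.point + (e.1.length + lenL (fun b => plen φ b.point) e.1) := by
  have h1 := sum_sum_single (Enum.point φ) e.1 (fun b k => k * plen φ b) (by simp)
    (fun _ _ _ => add_mul _ _ _)
  have h2 := sum_sum_single (Enum.point φ) e.1 (fun _ k => k) (by simp) (fun _ _ _ => rfl)
  simp only [one_mul] at h1
  rw [List.map_const', List.sum_replicate, smul_eq_mul, mul_one] at h2
  rw [← add_assoc]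
  exact congrArg₂ (fun x y => nlen ψ e.2.point + x + y) h2 h1

theorem sep_loc_basis (n k : ℕ) :
    Sep (fun _ => basis ℝ≥0∞ n) n ∧ Loc (fun _ => basis ℝ≥0∞ n) k := by
  refine ⟨fun ε hε w w' h => ?_, fun _ _ _ => rfl⟩
  have h0 := h (fun _ => 0) ⟨fun i => ⟨0, by simp⟩, by simp⟩
  have hw : ∀ w : ℕ → ℝ≥0∞, ∑' i, basis ℝ≥0∞ n i * w i = w n := fun w => by
    rw [tsum_eq_single n fun i hi => by simp [basis, hi]]
    simp [basis]
  rwa [hw, hw] at h0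

theorem sep_loc_psem_nsem (σ : Ty) :
    (∀ e : Enum σ, Sep (psem σ e) e.point ∧ Loc (psem σ e) (plen σ e.point)) ∧
      ∀ e : Enum σ, Sep (nsem σ e) e.point ∧ Loc (nsem σ e) (nlen σ e.point) := by
  induction σ with
  | nat => exact ⟨fun (e : ℕ) => sep_loc_basis e 0, fun (e : ℕ) => sep_loc_basis e 0⟩
  | arr φ ψ ihφ ihψ =>
    constructor
    · intro (e : List (Enum φ) × Enum ψ)
      have hS := sep_prodL (nsem φ) (fun b => nlen φ b.point) (Enum.point φ) e.1
        (fun b => (ihφ.2 b).1) fun b => (ihφ.2 b).2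
      have hL : Loc (fun u m => MvPowerSeries.coeff m
          (prodL (nsem φ) (fun b => nlen φ b.point) e.1 u)) _ := fun u v h => by
        simp only
        rw [loc_prodL (nsem φ) (fun b => nlen φ b.point) e.1 (fun b => (ihφ.2 b).2) u v h]
      refine ⟨hS.prod hL (ihψ.1 e.2).1, ?_⟩
      rw [plen_point_arr]
      exact hL.prod (ihψ.1 e.2).2
    · intro (e : List (Enum φ) × Enum ψ)
      have hS := sep_mon_mixL (psem φ) (fun b => plen φ b.point) (Enum.point φ) e.1
        (fun b => (ihφ.1 b).1) fun b => (ihφ.1 b).2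
      have hL := loc_mon_mixL (psem φ) (fun b => plen φ b.point) e.1 fun b => (ihφ.1 b).2
      refine ⟨hS.prod hL (ihψ.2 e.2).1, ?_⟩
      rw [nlen_point_arr]
      exact hL.prod (ihψ.2 e.2).2

end PPCF

namespace PCoh

/-! ### Vectors of coherence spaces, with values in `[0, ∞]` -/

/-- `g` belongs to the orthogonal of `X`. -/
def PCS.EOrth (X : PCS) (g : X.web → ℝ≥0∞) : Prop :=
  ∀ v ∈ X.P, ∑' a, (v a : ℝ≥0∞) * g a ≤ 1

/-- `f` belongs to `X`. -/
def PCS.EMem (X : PCS) (f : X.web → ℝ≥0∞) : Prop :=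
  ∀ g, X.EOrth g → ∑' a, f a * g a ≤ 1

theorem PCS.eMem_coe (X : PCS) {v : X.web → ℝ≥0} (hv : v ∈ X.P) :
    X.EMem fun a => (v a : ℝ≥0∞) := fun _ hg => hg v hv

theorem PCS.eOrth_coe (X : PCS) {v : X.web → ℝ≥0} (hv : v ∈ orth X.P) :
    X.EOrth fun a => (v a : ℝ≥0∞) := fun u hu => hv u hu

theorem ne_top_of_tsum_mul_le {I : Type} {f g : I → ℝ≥0∞} (h : ∑' a, f a * g a ≤ 1) {a : I}
    (ha : f a ≠ 0) : g a ≠ ⊤ := by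
  intro ht
  have := (ENNReal.le_tsum (f := fun a => f a * g a) a).trans h
  simp [ht, ENNReal.mul_top ha] at this

theorem PCS.EOrth.exists_coe {X : PCS} {g : X.web → ℝ≥0∞} (hg : X.EOrth g) :
    ∃ v ∈ orth X.P, g = fun a => (v a : ℝ≥0∞) := by
  have hfin : ∀ a, g a ≠ ⊤ := by
    intro a
    obtain ⟨u, hu, hpos⟩ := X.exists_pos a
    exact ne_top_of_tsum_mul_le (hg u hu) (by exact_mod_cast hpos.ne')
  lift g to X.web → ℝ≥0 using hfin
  exact ⟨g, fun u hu => hg u hu, rfl⟩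

/-- An infinite entry is impossible, since each coordinate is positive on some vector of the
orthogonal. -/
theorem PCS.EMem.exists_coe {X : PCS} {f : X.web → ℝ≥0∞} (hf : X.EMem f) :
    ∃ v ∈ X.P, f = fun a => (v a : ℝ≥0∞) := by
  have hfin : ∀ a, f a ≠ ⊤ := by
    intro a
    obtain ⟨u, hu, hpos⟩ := X.orth_exists_pos a
    have := hf _ (X.eOrth_coe hu)
    simp_rw [mul_comm (f _)] at this
    exact ne_top_of_tsum_mul_le this (by exact_mod_cast hpos.ne')
  lift f to X.web → ℝ≥0 using hfin
  refine ⟨f, ?_, rfl⟩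
  rw [← X.biorth]
  intro u hu
  rw [pair_comm]
  exact hf _ (X.eOrth_coe hu)

theorem PCS.EMem.mul_left {X : PCS} {f : X.web → ℝ≥0∞} (hf : X.EMem f) {r : ℝ≥0∞} (hr : r ≤ 1) :
    X.EMem fun a => r * f a := by
  intro g hg
  simp_rw [mul_assoc, ENNReal.tsum_mul_left]
  exact mul_le_one' hr (hf g hg)

theorem coe_prom {I : Type} (x : I → ℝ≥0) (μ : I →₀ ℕ) :
    ((prom x μ : ℝ≥0) : ℝ≥0∞) = mon (fun a => (x a : ℝ≥0∞)) μ :=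
  map_mon ENNReal.ofNNRealHom x μ

theorem PCS.EMem.funApp {X Y : PCS} {s : (X.web →₀ ℕ) × Y.web → ℝ≥0∞}
    (hs : (limpl (excl X) Y).EMem s) {x : X.web → ℝ≥0∞} (hx : X.EMem x) :
    Y.EMem (funApp s x) := by
  intro g hg
  obtain ⟨x, hx', rfl⟩ := hx.exists_coe
  obtain ⟨g, hg', rfl⟩ := hg.exists_coe
  have := hs (fun p => ((tens (prom x) g p : ℝ≥0) : ℝ≥0∞)) fun v hv => by
    have := hv _ ⟨prom x, subset_biorth _ ⟨x, hx', rfl⟩, g, hg', rfl⟩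
    rwa [pair_comm] at this
  refine le_of_eq_of_le ?_ this
  rw [ENNReal.tsum_prod (f := fun μ b => s (μ, b) * ((tens (prom x) g (μ, b) : ℝ≥0) : ℝ≥0∞)),
    ENNReal.tsum_comm]
  refine tsum_congr fun b => ?_
  rw [PCoh.funApp, ← ENNReal.tsum_mul_right]
  refine tsum_congr fun μ => ?_
  rw [tens, ENNReal.coe_mul, coe_prom, mul_assoc]
  rfl

/-- Mapping `X` into `Y` is a condition on promotions only. For `v` in the orthogonal of `Y`, it
says that `μ ↦ ∑ b, s (μ, b) * v b` is orthogonal to all promotions, hence to their whole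
bi-orthogonal `P (!X)`. -/
theorem PCS.eMem_limpl {X Y : PCS} {s : (X.web →₀ ℕ) × Y.web → ℝ≥0∞}
    (hs : ∀ x, X.EMem x → Y.EMem (PCoh.funApp s x)) : (limpl (excl X) Y).EMem s := by
  have hsum : ∀ v ∈ orth Y.P, ∀ x ∈ X.P,
      ∑' μ, ((prom x μ : ℝ≥0) : ℝ≥0∞) * ∑' b, s (μ, b) * (v b : ℝ≥0∞) ≤ 1 := by
    intro v hv x hx
    refine le_of_eq_of_le ?_ (hs _ (X.eMem_coe hx) _ (Y.eOrth_coe hv))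
    simp_rw [PCoh.funApp, ← ENNReal.tsum_mul_left, ← ENNReal.tsum_mul_right]
    rw [ENNReal.tsum_comm]
    refine tsum_congr fun b => tsum_congr fun μ => ?_
    rw [coe_prom, mul_left_comm, ← mul_assoc]
    rfl
  have htfin : ∀ v ∈ orth Y.P, ∀ μ, ∑' b, s (μ, b) * (v b : ℝ≥0∞) ≠ ⊤ := by
    intro v hv μ
    obtain ⟨x, hx, hpos⟩ := X.exists_pos_on μ
    refine ne_top_of_tsum_mul_le (hsum v hv x hx) (a := μ) ?_
    rw [ENNReal.coe_ne_zero]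
    exact (Finset.prod_pos fun a ha => pow_pos (hpos a ha) _).ne'
  have hfin : ∀ p, s p ≠ ⊤ := by
    rintro ⟨μ, b⟩ ht
    obtain ⟨v, hv, hpos⟩ := Y.orth_exists_pos b
    refine htfin v hv μ (top_unique ?_)
    refine le_of_eq_of_le ?_ (ENNReal.le_tsum b)
    rw [ht, ENNReal.top_mul (by exact_mod_cast hpos.ne')]
  lift s to (X.web →₀ ℕ) × Y.web → ℝ≥0 using hfin
  refine PCS.eMem_coe (limpl (excl X) Y) ?_
  rintro _ ⟨U, hU, v, hv, rfl⟩
  have hU' := hU (fun μ => (∑' b, ((s (μ, b) : ℝ≥0) : ℝ≥0∞) * (v b : ℝ≥0∞)).toNNReal) (by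
    rintro _ ⟨x, hx, rfl⟩
    refine le_of_eq_of_le ?_ (hsum v hv x hx)
    exact tsum_congr fun μ => by rw [ENNReal.coe_toNNReal (htfin v hv μ)])
  refine le_of_eq_of_le ?_ hU'
  rw [pair, pair, ENNReal.tsum_prod
    (f := fun μ b => ((tens U v (μ, b) : ℝ≥0) : ℝ≥0∞) * (s (μ, b) : ℝ≥0∞))]
  refine tsum_congr fun μ => ?_
  rw [ENNReal.coe_toNNReal (htfin v hv μ), ← ENNReal.tsum_mul_right]
  refine tsum_congr fun b => ?_
  rw [tens, ENNReal.coe_mul]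
  ring

end PCoh

namespace PPCF

open PCoh InfSum

/-! ### The testing terms take values in the coherence spaces -/

theorem tsum_drop_le (n : ℕ) (u : ℕ → ℝ≥0∞) : ∑' i, drop n u i ≤ ∑' i, u i :=
  ENNReal.tsum_comp_le_tsum_of_injective (add_left_injective n) u

/-- With weights of sum at most `1`, the combination is sub-convex and so stays in `X`. -/
theorem tsum_mixL_mul_le {B : Type} {X : PCS} (P : B → (ℕ → ℝ≥0∞) → X.web → ℝ≥0∞) (len : B → ℕ)
    (hP : ∀ b u, ∑' i, u i ≤ 1 → X.EMem (P b u)) (l : List B) (t v : ℕ → ℝ≥0∞)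
    (hv : ∑' i, v i ≤ 1) (g : X.web → ℝ≥0∞) (hg : X.EOrth g) :
    ∑' a, mixL P len l t v a * g a ≤ ∑' i, t i := by
  induction l generalizing t v with
  | nil => simp [mixL]
  | cons b l ih =>
    simp_rw [mixL, add_mul, mul_assoc]
    rw [ENNReal.tsum_add, ENNReal.tsum_mul_left, tsum_eq_zero_add' (f := t) ENNReal.summable]
    exact add_le_add (mul_le_of_le_one_right' (hP b v hv g hg))
      (ih _ _ ((tsum_drop_le _ v).trans hv))

theorem ev_prodL_le {B : Type} {X : PCS} (N : B → (ℕ → ℝ≥0∞) → X.web → ℝ≥0∞) (len : B → ℕ)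
    {x : X.web → ℝ≥0∞} (hN : ∀ b u, ∑' i, u i ≤ 1 → ∑' a, N b u a * x a ≤ 1) (l : List B)
    (v : ℕ → ℝ≥0∞) (hv : ∑' i, v i ≤ 1) : ev x (prodL N len l v) ≤ 1 := by
  induction l generalizing v with
  | nil => simp [prodL]
  | cons b l ih =>
    rw [prodL, map_mul, ev_linForm]
    exact mul_le_one' (hN b v hv) (ih _ ((tsum_drop_le _ v).trans hv))

theorem eMem_basis (n : ℕ) : natPCS.EMem (basis ℝ≥0∞ n) := by
  have h : (Pi.single n 1 : ℕ → ℝ≥0) ∈ natPCS.P := by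
    change ∑' k, ((Pi.single n 1 : ℕ → ℝ≥0) k : ℝ≥0∞) ≤ 1
    rw [tsum_eq_single n (fun b hb => by simp [Pi.single_eq_of_ne hb])]
    simp
  convert natPCS.eMem_coe h using 2 with k
  by_cases hk : k = n
  · simp [hk, basis]
  · simp [hk, basis]

/-- This supplies the finiteness required by `EqFin`; the joint induction uses that products of
numbers at most `1` and sub-convex combinations respect the bounds. -/
theorem psem_nsem_bound (σ : Ty) :
    (∀ (e : Enum σ) (u : ℕ → ℝ≥0∞), ∑' i, u i ≤ 1 → σ.interp.EMem (psem σ e u)) ∧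
      ∀ (e : Enum σ) (u : ℕ → ℝ≥0∞) (w : σ.Web → ℝ≥0∞), ∑' i, u i ≤ 1 → σ.interp.EMem w →
        ∑' b, nsem σ e u b * w b ≤ 1 := by
  induction σ with
  | nat =>
    refine ⟨fun (e : ℕ) u _ => eMem_basis e, fun (e : ℕ) u w _ hw => ?_⟩
    have h1 := hw (fun _ => 1) fun v hv => by simpa using hv
    change ∑' b : ℕ, basis ℝ≥0∞ e b * w b ≤ 1
    rw [tsum_eq_single e fun i hi => by simp [basis, hi]]
    refine le_trans ?_ h1
    refine le_of_eq_of_le ?_ (ENNReal.le_tsum e)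
    simp [basis]
  | arr φ ψ ihφ ihψ =>
    constructor
    · intro (e : List (Enum φ) × Enum ψ) u hu
      refine PCS.eMem_limpl fun x hx => ?_
      have h : funApp (psem (.arr φ ψ) e u) x = fun c =>
          ev x (prodL (nsem φ) (fun b => nlen φ b.point) e.1 u) *
            psem ψ e.2 (drop (lenL (fun b => nlen φ b.point) e.1) u) c := by
        funext c
        rw [ev_apply, isum_ennreal, ← ENNReal.tsum_mul_right]
        exact tsum_congr fun m => mul_right_comm _ _ _
      rw [h]
      exact (ihψ.1 e.2 _ ((tsum_drop_le _ u).trans hu)).mul_left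
        (ev_prodL_le _ _ (fun b u hu => ihφ.2 b u x hu hx) _ _ hu)
    · intro (e : List (Enum φ) × Enum ψ) u w hu hw
      have hx : φ.interp.EMem (mixL (psem φ) (fun b => plen φ b.point) e.1 u (drop e.1.length u)) :=
        fun g hg => (tsum_mixL_mul_le _ _ ihφ.1 _ _ _ ((tsum_drop_le _ u).trans hu) g hg).trans hu
      refine le_of_eq_of_le ?_
        (ihψ.2 e.2 (drop (e.1.length + lenL (fun b => plen φ b.point) e.1) u) _
          ((tsum_drop_le _ u).trans hu) (PCS.EMem.funApp hw hx))
      refine (tsum_mul_prod _ _ w).trans (tsum_congr fun c => ?_)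
      congr 1
      exact tsum_congr fun m => mul_comm _ _

end PPCF
end

-- The separation theorem.

theorem mainTheorem4 (σ : PPCF.Ty) (a : σ.Web) (w w' : σ.Web → ℝ≥0)
    (hw : w ∈ σ.interp.P) (hw' : w' ∈ σ.interp.P) (hne : w a ≠ w' a) :
    ∀ e : PPCF.Enum σ, e.point = a →
      ∃ q : Fin (PPCF.nlen σ a) → ℚ≥0, ∃ u : ℕ → ℝ≥0,
        u = ∑ i : Fin (PPCF.nlen σ a), (q i : ℝ≥0) • Pi.single (i : ℕ) (1 : ℝ≥0) ∧
        u ∈ PPCF.Ty.nat.interp.P ∧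
        PCoh.funApp (PCoh.funApp (PPCF.ntest σ e).csem (fun n => (u n : ℝ≥0∞)))
            (fun b => (w b : ℝ≥0∞)) ≠
          PCoh.funApp (PCoh.funApp (PPCF.ntest σ e).csem (fun n => (u n : ℝ≥0∞)))
            (fun b => (w' b : ℝ≥0∞)) := by
  intro e he
  subst he
  by_contra! hall
  obtain ⟨hsep, hloc⟩ := (PPCF.sep_loc_psem_nsem σ).2 e
  refine hne ?_
  -- The bound `1` on the sum of the parameters is membership in `P N`.
  have key := hsep 1 one_pos (fun b => (w b : ℝ≥0∞)) (fun b => (w' b : ℝ≥0∞)) fun u hu => by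
    obtain ⟨hq, hsum⟩ := hu
    choose q hq using hq
    set n := PPCF.nlen σ (PPCF.Enum.point σ e) with hn
    -- Separation quantifies over infinite parameter sequences; since the test depends only on the
    -- first `n` entries, truncation does not change its value.
    set v : ℕ → ℝ≥0 := ∑ i : Fin n, (q i : ℝ≥0) • Pi.single (i : ℕ) (1 : ℝ≥0) with hv
    have hvi : ∀ j, v j = if j < n then (q j : ℝ≥0) else 0 := by
      intro j
      rw [hv, Finset.sum_apply]
      split_ifs with hj
      · rw [Finset.sum_eq_single ⟨j, hj⟩]
        · simp
        · intro i _ hi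
          have : j ≠ i := fun h => hi (Fin.ext h.symm)
          simp [this]
        · simp
      · refine Finset.sum_eq_zero fun i _ => ?_
        have : j ≠ i := fun h => hj (h ▸ i.2)
        simp [this]
    have hvmem : v ∈ PPCF.Ty.nat.interp.P := by
      refine le_trans (ENNReal.tsum_le_tsum fun j => ?_) hsum
      rw [hvi, hq]
      split_ifs <;> simp
    have huv := hloc u (fun j => (v j : ℝ≥0∞)) fun i hi => by rw [hvi, if_pos hi, hq]
    have h := congrFun (hall (fun i => q i) v hv hvmem) (0 : ℕ)
    rw [PPCF.funApp_ntest, PPCF.funApp_ntest, ← huv] at h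
    exact ⟨h, ne_top_of_le_ne_top ENNReal.one_ne_top
      ((PPCF.psem_nsem_bound σ).2 e u _ hsum (PCoh.PCS.eMem_coe _ hw))⟩
  exact_mod_cast key.1
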